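/- Assume Ostaszewski's $\clubsuit$-principle: there is a family $(S_\lambda)$, indexed by the countable limit ordinals $\lambda$, such that each $S_\lambda$ is a cofinal subset of $\lambda$ of order type $\omega$, and every uncountable subset of $\omega_1$ contains some $S_\lambda$. Then there is a non-metrizable scattered locally compact Hausdorff space $L$ (scattered: every non-empty $A\subseteq L$ has a point that is isolated in $A$) with the following property. For all countable ordinals $\alpha,\beta$ and every bounded linear operator $T:C_0(\alpha\times L)\to C_0(\beta\times L)$ there are a unique bounded linear operator $R:C_0(\alpha)\to C_0(\beta)$ and a unique bounded linear operator $S:C_0(\alpha\times L)\to C_0(\beta\times L)$ with separable image such that $$T=R_L+S .$$ Here an ordinal $\alpha$ is regarded as the space $[0,\alpha)$ with its order topology; $C_0(X)$ is the Banach space of real continuous functions on $X$ vanishing at infinity, with the supremum norm; and $R_L:C_0(\alpha\times L)\to C_0(\beta\times L)$ is the bounded linear operator $R_L(f)(x,y)=R\big(f(\cdot,y)\big)(x)$ for $(x,y)\in\beta\times L$, where $f(\cdot,y)\in C_0(\alpha)$ is the restriction of $f$ to the fibre over $y$. -/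

import Mathlib

open Set Filter Topology
open scoped ZeroAtInfty

/-- Ostaszewski's club principle: there is a family of sets `S l`, indexed by the countable limit
ordinals `l`, such that each `S l` is a cofinal subset of `l` of order type `ω`, and every
uncountable subset of `ω₁` contains some `S l`. -/
def OstaszewskiClub : Prop :=
  ∃ S : Ordinal.{0} → Set Ordinal.{0},
    (∀ l : Ordinal.{0}, l < Ordinal.omega 1 → Order.IsSuccLimit l →
      (∃ e : ℕ → Ordinal.{0}, StrictMono e ∧ S l = Set.range e) ∧
      S l ⊆ Set.Iio l ∧ ∀ a < l, ∃ b ∈ S l, a < b) ∧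
    ∀ X : Set Ordinal.{0}, X ⊆ Set.Iio (Ordinal.omega 1) → ¬ X.Countable →
      ∃ l : Ordinal.{0}, l < Ordinal.omega 1 ∧ Order.IsSuccLimit l ∧ S l ⊆ X

/-- A topological space is scattered if every nonempty subset `A` has a point that is isolated
in `A`. -/
def IsScatteredSpace (X : Type*) [TopologicalSpace X] : Prop :=
  ∀ A : Set X, A.Nonempty → ∃ a ∈ A, ∃ U : Set X, IsOpen U ∧ U ∩ A = {a}

/-- The ordinal `a`, viewed as the space `[0, a)` of all smaller ordinals; the topology is the
subspace topology from the order topology of the ordinals, i.e. the order topology. -/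
abbrev OrdinalSpace (a : Ordinal.{0}) : Type 1 := Set.Iio a

section Fibrewise

variable {A B L : Type*} [TopologicalSpace A] [TopologicalSpace B] [TopologicalSpace L]

theorem C0_exists_compact {X : Type*} [TopologicalSpace X] (f : C₀(X, ℝ)) {e : ℝ} (he : 0 < e) :
    ∃ K : Set X, IsCompact K ∧ ∀ x, x ∉ K → |f x| < e := by
  have h := (Metric.tendsto_nhds.1 f.zero_at_infty') e he
  obtain ⟨K, hK, hs⟩ := mem_cocompact.1 h
  refine ⟨K, hK, fun x hx => ?_⟩
  have := hs hx
  simpa [Real.dist_eq] using this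

theorem C0_norm_coe_le {X : Type*} [TopologicalSpace X] (f : C₀(X, ℝ)) (x : X) :
    |f x| ≤ ‖f‖ := by
  have := f.toBCF.norm_coe_le_norm x
  simpa using this

theorem C0_norm_le {X : Type*} [TopologicalSpace X] (f : C₀(X, ℝ)) {c : ℝ} (hc : 0 ≤ c)
    (h : ∀ x, |f x| ≤ c) : ‖f‖ ≤ c := by
  have : ‖f.toBCF‖ ≤ c := (BoundedContinuousFunction.norm_le hc).2 (fun x => by simpa using h x)
  simpa using this

/-- The restriction `x ↦ f (x, y)` of `f ∈ C₀(A × L)` to the fibre `A × {y}`. -/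
def fibre (f : C₀(A × L, ℝ)) (y : L) : C₀(A, ℝ) where
  toFun x := f (x, y)
  continuous_toFun := f.continuous.comp (by fun_prop)
  zero_at_infty' := by
    rw [Metric.tendsto_nhds]
    intro e he
    obtain ⟨K, hK, h⟩ := C0_exists_compact f he
    refine mem_cocompact.2 ⟨Prod.fst '' K, hK.image continuous_fst, fun x hx => ?_⟩
    have := h (x, y) (fun hm => hx ⟨_, hm, rfl⟩)
    simpa [Real.dist_eq] using this

@[simp] theorem fibre_apply (f : C₀(A × L, ℝ)) (y : L) (x : A) : fibre f y x = f (x, y) := rfl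

theorem continuous_fibre (f : C₀(A × L, ℝ)) : Continuous (fibre f) := by
  rw [continuous_iff_continuousAt]
  intro y0
  rw [ContinuousAt, Metric.tendsto_nhds]
  intro e he
  obtain ⟨K, hK, h⟩ := C0_exists_compact f (e := e / 4) (by positivity)
  have hK1 : IsCompact (Prod.fst '' K) := hK.image continuous_fst
  have key : ∀ᶠ y in 𝓝 y0, ∀ x ∈ Prod.fst '' K, |f (x, y) - f (x, y0)| < e / 2 := by
    refine hK1.eventually_forall_of_forall_eventually fun x _ => ?_
    have hc : Continuous fun z : L × A => |f (z.2, z.1) - f (z.2, y0)| := by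
      have := f.continuous
      fun_prop
    have := hc.continuousAt (x := (y0, x))
    exact this.eventually_lt_const (by simpa using by positivity)
  filter_upwards [key] with y hy
  rw [dist_eq_norm]
  refine lt_of_le_of_lt (C0_norm_le _ (c := e / 2) (by positivity) fun x => ?_) (by linarith)
  simp only [ZeroAtInftyContinuousMap.coe_sub, Pi.sub_apply, fibre_apply]
  by_cases hx : x ∈ Prod.fst '' K
  · exact (hy x hx).le
  · have h1 := abs_lt.1 (h (x, y) (fun hm => hx ⟨_, hm, rfl⟩))
    have h2 := abs_lt.1 (h (x, y0) (fun hm => hx ⟨_, hm, rfl⟩))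
    rw [abs_le]
    constructor <;> linarith [h1.1, h1.2, h2.1, h2.2]

theorem norm_fibre_le (f : C₀(A × L, ℝ)) (y : L) : ‖fibre f y‖ ≤ ‖f‖ :=
  C0_norm_le _ (norm_nonneg _) fun x => C0_norm_coe_le f (x, y)

/-- The function `(x, y) ↦ R (f restricted to A × {y}) x`, as an element of `C₀(B × L)`. -/
noncomputable def fibrewiseFun (R : C₀(A, ℝ) →L[ℝ] C₀(B, ℝ)) (f : C₀(A × L, ℝ)) :
    C₀(B × L, ℝ) where
  toFun p := R (fibre f p.2) p.1
  continuous_toFun := by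
    rw [continuous_iff_continuousAt]
    rintro ⟨x0, y0⟩
    rw [ContinuousAt, Metric.tendsto_nhds]
    intro e he
    have h1 : ∀ᶠ p : B × L in 𝓝 (x0, y0), dist (R (fibre f p.2)) (R (fibre f y0)) < e / 2 := by
      have hc : Continuous fun p : B × L => R (fibre f p.2) :=
        R.continuous.comp ((continuous_fibre f).comp continuous_snd)
      exact (Metric.tendsto_nhds.1 (hc.tendsto (x0, y0))) (e / 2) (by positivity)
    have h2 : ∀ᶠ p : B × L in 𝓝 (x0, y0),
        dist (R (fibre f y0) p.1) (R (fibre f y0) x0) < e / 2 := by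
      have hc : Continuous fun p : B × L => R (fibre f y0) p.1 :=
        (R (fibre f y0)).continuous.comp continuous_fst
      exact (Metric.tendsto_nhds.1 (hc.tendsto (x0, y0))) (e / 2) (by positivity)
    filter_upwards [h1, h2] with p hp1 hp2
    have h3 : dist (R (fibre f p.2) p.1) (R (fibre f y0) p.1) < e / 2 := by
      refine lt_of_le_of_lt ?_ hp1
      rw [dist_eq_norm (R (fibre f p.2)), Real.dist_eq]
      exact C0_norm_coe_le (R (fibre f p.2) - R (fibre f y0)) p.1
    linarith [dist_triangle (R (fibre f p.2) p.1) (R (fibre f y0) p.1) (R (fibre f y0) x0)]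
  zero_at_infty' := by
    rw [Metric.tendsto_nhds]
    intro e he
    have hR : 0 < ‖R‖ + 1 := by positivity
    obtain ⟨K, hK, h⟩ := C0_exists_compact f (e := e / (2 * (‖R‖ + 1))) (by positivity)
    have hK2 : IsCompact (Prod.snd '' K) := hK.image continuous_snd
    have hloc : ∀ y ∈ Prod.snd '' K, ∃ U ∈ 𝓝[Prod.snd '' K] y, ∃ C : Set B, IsCompact C ∧
        ∀ x ∉ C, ∀ y' ∈ U, |R (fibre f y') x| < e := by
      intro y _
      obtain ⟨C, hC, hCb⟩ := C0_exists_compact (R (fibre f y)) (e := e / 2) (by positivity)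
      have hc : Continuous fun y' => R (fibre f y') := R.continuous.comp (continuous_fibre f)
      have hn := (Metric.tendsto_nhds.1 (hc.tendsto y)) (e / 2) (by positivity)
      refine ⟨_, mem_nhdsWithin_of_mem_nhds hn, C, hC, fun x hx y' hy' => ?_⟩
      have h1 := hCb x hx
      have h2 : dist (R (fibre f y')) (R (fibre f y)) < e / 2 := hy'
      have h3 := C0_norm_coe_le (R (fibre f y') - R (fibre f y)) x
      rw [dist_eq_norm] at h2
      simp only [ZeroAtInftyContinuousMap.coe_sub, Pi.sub_apply] at h3
      have h4 := abs_le.1 (h3.trans h2.le)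
      have h5 := abs_lt.1 h1
      rw [abs_lt]
      constructor <;> linarith [h4.1, h4.2, h5.1, h5.2]
    have hunif : ∃ C : Set B, IsCompact C ∧
        ∀ x ∉ C, ∀ y' ∈ Prod.snd '' K, |R (fibre f y') x| < e := by
      refine hK2.induction_on (p := fun s => ∃ C : Set B, IsCompact C ∧
        ∀ x ∉ C, ∀ y' ∈ s, |R (fibre f y') x| < e) ?_ ?_ ?_ ?_
      · exact ⟨∅, isCompact_empty, by simp⟩
      · rintro s t hst ⟨C, hC, hb⟩
        exact ⟨C, hC, fun x hx y' hy' => hb x hx y' (hst hy')⟩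
      · rintro s t ⟨C, hC, hb⟩ ⟨D, hD, hd⟩
        refine ⟨C ∪ D, hC.union hD, fun x hx y' hy' => ?_⟩
        rcases hy' with hy' | hy'
        · exact hb x (fun hm => hx (Or.inl hm)) y' hy'
        · exact hd x (fun hm => hx (Or.inr hm)) y' hy'
      · intro y hy
        obtain ⟨U, hU, hUC⟩ := hloc y hy
        exact ⟨U, hU, hUC⟩
    obtain ⟨C, hC, hCb⟩ := hunif
    refine mem_cocompact.2 ⟨C ×ˢ (Prod.snd '' K), hC.prod hK2, fun p hp => ?_⟩
    have goal : |R (fibre f p.2) p.1| < e := by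
      by_cases hy : p.2 ∈ Prod.snd '' K
      · exact hCb p.1 (fun hx => hp ⟨hx, hy⟩) p.2 hy
      · have h1 : ‖fibre f p.2‖ ≤ e / (2 * (‖R‖ + 1)) :=
          C0_norm_le _ (by positivity) fun x => (h (x, p.2) (fun hm => hy ⟨_, hm, rfl⟩)).le
        have h2 : |R (fibre f p.2) p.1| ≤ ‖R‖ * (e / (2 * (‖R‖ + 1))) :=
          (C0_norm_coe_le _ _).trans ((R.le_opNorm _).trans (by gcongr))
        have h3 : ‖R‖ * (e / (2 * (‖R‖ + 1))) ≤ (‖R‖ + 1) * (e / (2 * (‖R‖ + 1))) := by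
          gcongr
          linarith
        have h4 : (‖R‖ + 1) * (e / (2 * (‖R‖ + 1))) = e / 2 := by
          field_simp
        linarith
    simpa [Real.dist_eq] using goal

/-- For a bounded operator `R : C₀(A) → C₀(B)`, the bounded operator `R_L : C₀(A × L) → C₀(B × L)`
that applies `R` fibrewise: `R_L f (x, y) = R (f restricted to A × {y}) x`. -/
noncomputable def fibrewise (L : Type*) [TopologicalSpace L] (R : C₀(A, ℝ) →L[ℝ] C₀(B, ℝ)) :
    C₀(A × L, ℝ) →L[ℝ] C₀(B × L, ℝ) :=
  LinearMap.mkContinuous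
    { toFun := fibrewiseFun R
      map_add' := fun f g => by
        ext p
        have : fibre (f + g) p.2 = fibre f p.2 + fibre g p.2 := rfl
        change R (fibre (f + g) p.2) p.1 = R (fibre f p.2) p.1 + R (fibre g p.2) p.1
        rw [this, map_add]
        rfl
      map_smul' := fun c f => by
        ext p
        have : fibre (c • f) p.2 = c • fibre f p.2 := rfl
        change R (fibre (c • f) p.2) p.1 = c • R (fibre f p.2) p.1
        rw [this, map_smul]
        rfl }
    ‖R‖ fun f => C0_norm_le _ (by positivity) fun p =>
      (C0_norm_coe_le (R (fibre f p.2)) p.1).trans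
        ((R.le_opNorm _).trans (by gcongr; exact norm_fibre_le f p.2))

theorem fibrewise_apply (R : C₀(A, ℝ) →L[ℝ] C₀(B, ℝ)) (f : C₀(A × L, ℝ)) (x : B) (y : L) :
    fibrewise L R f (x, y) = R (fibre f y) x := rfl

end Fibrewise

/-!
The space `L` is `ω₁` with a topology finer than the order topology, built by recursion from the
club sequences. Every point of `ω₁` is made to code a triple `(p, q, G)` of two points and a finite
set `G ∋ p, q`. If the club sequence at a limit ordinal `l` codes triples `(p k, q k, G k)` with
`G k` inside the `k`-th interval of the sequence, then `l` becomes the limit of all `p k` and of the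
`q k` with `k` even: the basic neighbourhood of `l` consists of `l` and of compact open
neighbourhoods of these points that avoid the rest of `G k`. All other points are isolated. The
basic neighbourhoods are compact and open, initial segments are clopen and countable, so `L` is
locally compact, Hausdorff and scattered. By the club principle, uncountably many triples, given
with `G` arbitrarily high up, always contain a sequence treated in this way at some `l`; this is the
property `ClubSpace.guess`, and everything else about `L` follows from it. For instance, an
uncountable set has an accumulation point, so that `L` is not metrizable.

Let now `τ` assign to each compact open `W ⊆ L` a function `τ W` on `L`, which is continuous, has
countable support, and depends on `W` in a bounded additive way. For fixed `y`, the set function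
`W ↦ τ W y` is carried by a finite set up to any `ε` (`IsBoundedCharge.exists_finset`). If for
uncountably many `y` it were not concentrated at `y`, it would have a further atom `q`; after
passing to uncountably many `y` with the same numerical data, `guess` gives a compact open `V`
containing `y = p k` for all `k` but the atom `q k` only for even `k`, and then `τ V (p k)` cannot
converge. Similarly, the mass at `y` is the same constant for all but countably many `y`. This is
`ClubSpace.exists_const`.

For an operator `T` this applies to `τ W y = T (1_{[0, v] × W}) (x, y)`, for each of the countably
many pairs `(v, x)`. As the indicator functions of boxes `[0, v] × W` span a dense subspace
(`mem_closure_span_boxInd`), `T` agrees with a fibrewise operator off countably many fibres, and the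
functions living on countably many fibres form a separable space. Conversely, a separable set of
functions lives on countably many fibres, which gives uniqueness.
-/

open TopologicalSpace (CompactOpens)

/-! ### A locally compact topology from ladders -/

/-- Combinatorial data for a locally compact topology on a well-ordered set `L`. To each `l ∈ lim`
belong a strictly increasing cofinal sequence `bound l` below `l`, finite sets
`block l k ⊆ (bound l k, bound l (k + 1)]`, and subsets `sel l k ⊆ block l k` of points that are
selected to converge to `l`. The points outside `lim` become isolated; the values of the other
fields there are irrelevant. -/
class LadderSystem (L : Type*) [LinearOrder L] where
  lim : Set L
  bound : L → ℕ → L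
  block : L → ℕ → Finset L
  sel : L → ℕ → Finset L
  strictMono : ∀ l ∈ lim, StrictMono (bound l)
  bound_lt : ∀ l ∈ lim, ∀ k, bound l k < l
  cofinal : ∀ l ∈ lim, ∀ a < l, ∃ k, a < bound l k
  sel_subset : ∀ l k, sel l k ⊆ block l k
  block_mem : ∀ l ∈ lim, ∀ k, ∀ z ∈ block l k, z ∈ Ioc (bound l k) (bound l (k + 1))

namespace LadderSystem

variable {L : Type*} [LinearOrder L] [LadderSystem L]

theorem lt_of_mem_block {l : L} (hl : l ∈ lim) {k : ℕ} {z : L} (hz : z ∈ block l k) : z < l :=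
  (block_mem l hl k z hz).2.trans_lt (bound_lt l hl _)

variable [WellFoundedLT L]

/-- The basic neighbourhood of `l`, defined by recursion on `l`: next to `l` itself it contains,
for every `k`, the part inside `(bound l k, bound l (k + 1)]` of the neighbourhoods of the points
selected in the `k`-th block, minus the neighbourhoods of those points of the block that are
not selected. -/
noncomputable def nbhd : L → Set L :=
  (wellFounded_lt (α := L)).fix fun l ih =>
    {x | x = l ∨ l ∈ lim ∧ ∃ k, x ∈ Ioc (bound l k) (bound l (k + 1)) ∧
      ∃ z, ∃ hz : z < l, z ∈ sel l k ∧ x ∈ ih z hz ∧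
        ∀ w, ∀ hw : w < l, w ∈ block l k → w ∉ sel l k → w < z → x ∉ ih w hw}

/-- The part of `nbhd l` between `bound l k` and `bound l (k + 1)`. -/
def piece (l : L) (k : ℕ) : Set L :=
  Ioc (bound l k) (bound l (k + 1)) ∩ ⋃ z ∈ sel l k,
    (nbhd z ∩ ⋂ w ∈ (block l k).filter fun w => w ∉ sel l k ∧ w < z, (nbhd w)ᶜ)

theorem mem_nbhd {l x : L} : x ∈ nbhd l ↔ x = l ∨ l ∈ lim ∧ ∃ k, x ∈ piece l k := by
  rw [nbhd, WellFounded.fix_eq]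
  change _ ∨ _ ∧ (∃ k, _ ∧ ∃ z, ∃ _ : z < l, _ ∧ x ∈ nbhd z ∧
    ∀ w, ∀ _ : w < l, _ → _ → _ → x ∉ nbhd w) ↔ _
  simp only [piece, mem_inter_iff, mem_iUnion, mem_iInter, Finset.mem_filter,
    mem_compl_iff, exists_prop]
  refine or_congr_right (and_congr_right fun hl => exists_congr fun k => and_congr_right fun _ =>
    exists_congr fun z => ?_)
  constructor
  · rintro ⟨hz, hs, hx, h⟩
    exact ⟨hs, hx, fun w hw => h w (lt_of_mem_block hl hw.1) hw.1 hw.2.1 hw.2.2⟩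
  · rintro ⟨hs, hx, h⟩
    exact ⟨lt_of_mem_block hl (sel_subset _ _ hs), hs, hx, fun w _ h1 h2 h3 => h w ⟨h1, h2, h3⟩⟩

theorem self_mem_nbhd (l : L) : l ∈ nbhd l := mem_nbhd.2 (Or.inl rfl)

theorem nbhd_subset_Iic (l : L) : nbhd l ⊆ Iic l := by
  intro x hx
  obtain rfl | ⟨hl, k, hk⟩ := mem_nbhd.1 hx
  · exact le_rfl
  · exact hk.1.2.trans (bound_lt l hl _).le

theorem nbhd_of_notMem {l : L} (hl : l ∉ lim) : nbhd l = {l} := by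
  ext x
  simp [mem_nbhd, hl]

theorem piece_subset_nbhd {l : L} (hl : l ∈ lim) (k : ℕ) : piece l k ⊆ nbhd l :=
  fun _ hx => mem_nbhd.2 (Or.inr ⟨hl, k, hx⟩)

/-- Below a bound `bound l n`, only finitely many pieces of `nbhd l` matter. -/
theorem mem_piece_lt_of_le {l x : L} (hl : l ∈ lim) {n : ℕ} (hx : x ∈ nbhd l)
    (hn : x ≤ bound l n) : ∃ k < n, x ∈ piece l k := by
  obtain rfl | ⟨_, k, hk⟩ := mem_nbhd.1 hx
  · exact absurd hn (bound_lt _ hl n).not_ge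
  · exact ⟨k, (strictMono l hl).lt_iff_lt.1 (hk.1.1.trans_le hn), hk⟩

/-- The selection is visible in the neighbourhood: among the points of the `k`-th block,
`nbhd l` contains exactly the selected ones. -/
theorem mem_nbhd_iff_mem_sel {l z : L} (hl : l ∈ lim) {k : ℕ} (hz : z ∈ block l k) :
    z ∈ nbhd l ↔ z ∈ sel l k := by
  have hzI := block_mem l hl k z hz
  constructor
  · intro h
    obtain rfl | ⟨_, j, hj⟩ := mem_nbhd.1 h
    · exact absurd (lt_of_mem_block hl hz) (lt_irrefl _)
    · have h1 : j < k + 1 := (strictMono l hl).lt_iff_lt.1 (hj.1.1.trans_le hzI.2)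
      have h2 : k < j + 1 := (strictMono l hl).lt_iff_lt.1 (hzI.1.trans_le hj.1.2)
      obtain rfl : j = k := by omega
      by_contra hs
      have h3 := hj.2
      simp only [mem_iUnion, exists_prop] at h3
      obtain ⟨z', hz', hzz', h4⟩ := h3
      have hlt : z < z' := lt_of_le_of_ne (nbhd_subset_Iic z' hzz') (by rintro rfl; exact hs hz')
      simp only [mem_iInter, Finset.mem_filter] at h4
      exact h4 z ⟨hz, hs, hlt⟩ (self_mem_nbhd z)
  · intro hs
    refine piece_subset_nbhd hl k ⟨hzI, ?_⟩
    simp only [mem_iUnion, exists_prop]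
    refine ⟨z, hs, self_mem_nbhd z, ?_⟩
    simp only [mem_iInter, Finset.mem_filter]
    exact fun w hw hm => absurd (nbhd_subset_Iic w hm) (not_le.2 hw.2.2)

/-- A set is open if with each `l ∈ lim` it contains `nbhd l ∩ (m, l]` for some `m < l`. -/
@[reducible]
def topology : TopologicalSpace L where
  IsOpen O := ∀ l ∈ O, l ∈ lim → ∃ m < l, ∀ x ∈ nbhd l, m < x → x ∈ O
  isOpen_univ l _ hl := ⟨bound l 0, bound_lt l hl 0, fun _ _ _ => trivial⟩
  isOpen_inter s t hs ht l hl hlim := by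
    obtain ⟨m, hm, h⟩ := hs l hl.1 hlim
    obtain ⟨m', hm', h'⟩ := ht l hl.2 hlim
    exact ⟨max m m', max_lt hm hm', fun x hx hlt =>
      ⟨h x hx ((le_max_left _ _).trans_lt hlt), h' x hx ((le_max_right _ _).trans_lt hlt)⟩⟩
  isOpen_sUnion s hs l hl hlim := by
    obtain ⟨t, ht, hlt⟩ := hl
    obtain ⟨m, hm, h⟩ := hs t ht l hlt hlim
    exact ⟨m, hm, fun x hx hmx => ⟨t, ht, h x hx hmx⟩⟩

attribute [local instance] topology

theorem isOpen_iff_nbhd {O : Set L} :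
    IsOpen O ↔ ∀ l ∈ O, l ∈ lim → ∃ m < l, ∀ x ∈ nbhd l, m < x → x ∈ O := Iff.rfl

theorem isClopen_Iic (a : L) : IsClopen (Iic a) := by
  refine ⟨⟨?_⟩, ?_⟩ <;> rw [isOpen_iff_nbhd]
  · exact fun l hl _ => ⟨a, not_le.1 hl, fun x _ hx => not_le.2 hx⟩
  · exact fun l hl hlim => ⟨bound l 0, bound_lt l hlim 0,
      fun x hx _ => (nbhd_subset_Iic l hx).trans hl⟩

theorem isClopen_Ioi (a : L) : IsClopen (Ioi a) := by
  rw [← compl_Iic]; exact (isClopen_Iic a).compl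

theorem isClopen_piece_of_forall {l : L} (hl : l ∈ lim)
    (ih : ∀ z < l, IsClopen (nbhd z)) (k : ℕ) :
    IsClopen (piece l k) := by
  refine IsClopen.inter ((isClopen_Ioi _).inter (isClopen_Iic _)) ?_
  refine Set.Finite.isClopen_biUnion (sel l k).finite_toSet fun z hz => ?_
  refine (ih z (lt_of_mem_block hl (sel_subset _ _ hz))).inter ?_
  refine Set.Finite.isClopen_biInter (Finset.finite_toSet _) fun w hw => ?_
  exact (ih w (lt_of_mem_block hl (Finset.mem_filter.1 hw).1)).compl

theorem isClopen_nbhd (l : L) : IsClopen (nbhd l) := by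
  induction l using WellFoundedLT.induction with
  | ind l ih =>
  have hp := fun hl => isClopen_piece_of_forall (l := l) hl ih
  refine ⟨⟨?_⟩, ?_⟩ <;> rw [isOpen_iff_nbhd]
  · intro x hx hxlim
    rcases lt_trichotomy x l with h | h | h
    · by_cases hl : l ∈ lim
      · obtain ⟨n, hn⟩ := cofinal l hl x h
        -- near `x`, only the finitely many pieces below `bound l n` have to be avoided
        have hO : IsOpen (Iic x ∩ ⋂ k ∈ Finset.range n, (piece l k)ᶜ) :=
          (isClopen_Iic x).isOpen.inter
            (isOpen_biInter_finset fun k _ => (hp hl k).compl.isOpen)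
        have hxO : x ∈ (Iic x ∩ ⋂ k ∈ Finset.range n, (piece l k)ᶜ) := by
          refine ⟨le_rfl, ?_⟩
          simp only [mem_iInter]
          exact fun k _ hk => hx (piece_subset_nbhd hl k hk)
        obtain ⟨m, hm, H⟩ := hO x hxO hxlim
        refine ⟨m, hm, fun y hy hmy hyl => ?_⟩
        obtain ⟨h1, h2⟩ := H y hy hmy
        obtain ⟨k, hk, hyk⟩ := mem_piece_lt_of_le hl hyl (h1.trans hn.le)
        simp only [mem_iInter] at h2
        exact h2 k (Finset.mem_range.2 hk) hyk
      · refine ⟨bound x 0, bound_lt x hxlim 0, fun y hy _ hyl => ?_⟩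
        rw [nbhd_of_notMem hl] at hyl
        exact (h.trans_le hyl.ge).not_ge (nbhd_subset_Iic x hy)
    · exact absurd (h ▸ self_mem_nbhd x) hx
    · exact ⟨l, h, fun y _ hly hyl => (not_le.2 hly) (nbhd_subset_Iic l hyl)⟩
  · intro x hx hxlim
    obtain rfl | ⟨hl, k, hk⟩ := mem_nbhd.1 hx
    · exact ⟨bound x 0, bound_lt x hxlim 0, fun y hy _ => hy⟩
    · obtain ⟨m, hm, H⟩ := (hp hl k).isOpen x hk hxlim
      exact ⟨m, hm, fun y hy hmy => piece_subset_nbhd hl k (H y hy hmy)⟩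

theorem isCompact_nbhd (l : L) : IsCompact (nbhd l) := by
  induction l using WellFoundedLT.induction with
  | ind l ih =>
  by_cases hl : l ∈ lim
  swap
  · rw [nbhd_of_notMem hl]
    exact isCompact_singleton (X := L)
  rw [isCompact_iff_ultrafilter_le_nhds]
  intro f hf
  rw [le_principal_iff] at hf
  by_cases hle : (f : Filter L) ≤ 𝓝 l
  · exact ⟨l, self_mem_nbhd l, hle⟩
  -- an ultrafilter that does not converge to `l` lives on finitely many pieces
  obtain ⟨s, hs, hsf⟩ := Filter.not_le.1 hle
  obtain ⟨O, hOs, hO, hlO⟩ := mem_nhds_iff.1 hs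
  have hOf : Oᶜ ∈ f := Ultrafilter.compl_mem_iff_notMem.2 fun h => hsf (mem_of_superset h hOs)
  obtain ⟨m, hm, H⟩ := hO l hlO hl
  obtain ⟨n, hn⟩ := cofinal l hl m hm
  have hC : IsCompact (⋃ k ∈ Finset.range n, ⋃ z ∈ sel l k, nbhd z) :=
    Finset.isCompact_biUnion _ fun k _ => Finset.isCompact_biUnion _ fun z hz =>
      ih z (lt_of_mem_block hl (sel_subset _ _ hz))
  have hC' := hC.inter_right (isClopen_nbhd l).isClosed
  rw [isCompact_iff_ultrafilter_le_nhds] at hC'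
  have hfC : (⋃ k ∈ Finset.range n, ⋃ z ∈ sel l k, nbhd z) ∩ nbhd l ∈ f := by
    filter_upwards [hf, hOf] with x hx hxO
    refine ⟨?_, hx⟩
    have hxm : x ≤ m := not_lt.1 fun h => hxO (H x hx h)
    obtain ⟨k, hk, hxk⟩ := mem_piece_lt_of_le hl hx (hxm.trans hn.le)
    have h2 := hxk.2
    simp only [mem_iUnion, exists_prop, Finset.mem_range] at h2 ⊢
    obtain ⟨z, hz, hxz, _⟩ := h2
    exact ⟨k, hk, z, hz, hxz⟩
  obtain ⟨x, hx, hfx⟩ := hC' f (le_principal_iff.2 hfC)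
  exact ⟨x, hx.2, hfx⟩

instance : T2Space L := by
  refine ⟨fun x y hxy => ?_⟩
  rcases lt_or_gt_of_ne hxy with h | h
  · exact ⟨Iic x, Ioi x, (isClopen_Iic x).isOpen, (isClopen_Ioi x).isOpen, le_rfl, h,
      disjoint_left.2 fun z h1 h2 => not_lt.2 h1 h2⟩
  · exact ⟨Ioi y, Iic y, (isClopen_Ioi y).isOpen, (isClopen_Iic y).isOpen, h, le_rfl,
      disjoint_left.2 fun z h1 h2 => not_lt.2 h2 h1⟩

/-- The neighbourhood `nbhd l`, cut off below by the bounds in `o : Option L`. -/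
noncomputable def basicOpen (l : L) (o : Option L) :
    CompactOpens L where
  carrier := nbhd l ∩ ⋂ m ∈ o, Ioi m
  isCompact' := by
    refine (isCompact_nbhd l).inter_right ?_
    exact isClosed_iInter fun m => isClosed_iInter fun _ => (isClopen_Ioi m).isClosed
  isOpen' := by
    refine (isClopen_nbhd l).isOpen.inter ?_
    cases o with
    | none => simp
    | some m => simpa using (isClopen_Ioi m).isOpen

theorem exists_basicOpen {O : Set L} (hO : IsOpen O) {l : L} (hl : l ∈ O) :
    ∃ o : Option L, (∀ m ∈ o, m ≤ l) ∧ l ∈ basicOpen l o ∧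
      (basicOpen l o : Set L) ⊆ O := by
  by_cases hlim : l ∈ lim
  · obtain ⟨m, hm, H⟩ := hO l hl hlim
    refine ⟨some m, by simpa using hm.le, ⟨self_mem_nbhd l, by simpa using hm⟩, fun x hx => ?_⟩
    exact H x hx.1 (by simpa using hx.2)
  · refine ⟨none, by simp, ⟨self_mem_nbhd l, by simp⟩, fun x hx => ?_⟩
    have := hx.1
    rw [nbhd_of_notMem hlim] at this
    exact this ▸ hl

theorem tendsto_of_mem_nbhd {l : L} (hl : l ∈ lim) {x : ℕ → L} (hx : ∀ k, x k ∈ nbhd l)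
    (hb : ∀ k, bound l k < x k) : Tendsto x atTop (𝓝 l) := by
  intro s hs
  obtain ⟨O, hOs, hO, hlO⟩ := mem_nhds_iff.1 hs
  obtain ⟨m, hm, H⟩ := hO l hlO hl
  obtain ⟨n, hn⟩ := cofinal l hl m hm
  rw [mem_map]
  filter_upwards [eventually_ge_atTop n] with k hk
  exact hOs (H _ (hx k) ((hn.trans_le ((strictMono l hl).monotone hk)).trans (hb k)))

/-- Over a countable initial segment there are only countably many compact open sets. -/
theorem countable_compactOpens (hL : ∀ a : L, (Iic a).Countable) (a : L) :
    {V : CompactOpens L | (V : Set L) ⊆ Iic a}.Countable := by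
  have : Countable {x // x ≤ a} := (hL a).to_subtype
  have hinj : {V : CompactOpens L | (V : Set L) ⊆ Iic a} ⊆
      range fun F : Finset ({x // x ≤ a} × Option {x // x ≤ a}) =>
        F.sup fun z => basicOpen z.1.1 (z.2.map Subtype.val) := by
    intro V hV
    have key : ∀ x : L, x ∈ V → ∃ z : {x // x ≤ a} × Option {x // x ≤ a},
        x ∈ basicOpen z.1.1 (z.2.map Subtype.val) ∧ basicOpen z.1.1 (z.2.map Subtype.val) ≤ V := by
      intro x hx
      obtain ⟨o, ho, hxo, hoV⟩ := exists_basicOpen V.isOpen hx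
      refine ⟨⟨⟨x, hV hx⟩, o.pmap (fun m hm => ⟨m, hm⟩) fun m hm => (ho m hm).trans (hV hx)⟩, ?_⟩
      have : Option.map Subtype.val (o.pmap (fun m hm => (⟨m, hm⟩ : {x // x ≤ a}))
          fun m hm => (ho m hm).trans (hV hx)) = o := by
        cases o <;> simp
      dsimp only
      rw [this]
      exact ⟨hxo, hoV⟩
    choose z hz hzV using key
    obtain ⟨t, ht⟩ := V.isCompact.elim_nhds_subcover'
      (fun x hx => (basicOpen (z x hx).1.1 ((z x hx).2.map Subtype.val) : Set L))
      (fun x hx => (CompactOpens.isOpen _).mem_nhds (hz x hx))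
    classical
    refine ⟨t.image fun x => z x.1 x.2, le_antisymm ?_ ?_⟩
    · refine Finset.sup_le fun w hw => ?_
      obtain ⟨x, hx, rfl⟩ := Finset.mem_image.1 hw
      exact hzV x.1 x.2
    · intro x hx
      obtain ⟨y, hy, hxy⟩ := mem_iUnion₂.1 (ht hx)
      exact Finset.le_sup (f := fun z : {x // x ≤ a} × Option {x // x ≤ a} =>
        basicOpen z.1.1 (z.2.map Subtype.val))
        (Finset.mem_image_of_mem (fun x : (V : Set L) => z x.1 x.2) hy) hxy
  exact (countable_range _).mono hinj

end LadderSystem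

/-! ### Finitely additive functions on compact open sets -/

section FinitelyAdditive

variable {X : Type*} [TopologicalSpace X]

/-- A bounded finitely additive real function on the compact open sets. -/
structure IsBoundedCharge (φ : CompactOpens X → ℝ) : Prop where
  add : ∀ V W, Disjoint V W → φ (V ⊔ W) = φ V + φ W
  bounded : ∃ M, ∀ V, |φ V| ≤ M

namespace IsBoundedCharge

variable {φ : CompactOpens X → ℝ}

theorem neg (h : IsBoundedCharge φ) : IsBoundedCharge fun V => -φ V where
  add V W hVW := by rw [h.add V W hVW]; ring
  bounded := by simpa using h.bounded

theorem apply_bot (h : IsBoundedCharge φ) : φ ⊥ = 0 := by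
  have := h.add ⊥ ⊥ disjoint_bot_left
  simp only [bot_le, sup_of_le_left] at this
  linarith

theorem exists_le_of_disjoint (h : IsBoundedCharge φ) (O : Set X) {ε : ℝ} (hε : 0 < ε) :
    ∃ K : CompactOpens X, (K : Set X) ⊆ O ∧
      ∀ V : CompactOpens X, (V : Set X) ⊆ O → Disjoint K V → φ V ≤ ε := by
  obtain ⟨M, hM⟩ := h.bounded
  set S : Set ℝ := φ '' {V | (V : Set X) ⊆ O}
  have hS : BddAbove S := ⟨M, by rintro _ ⟨V, _, rfl⟩; exact (le_abs_self _).trans (hM V)⟩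
  have hne : S.Nonempty := ⟨_, ⊥, by simp, rfl⟩
  obtain ⟨_, ⟨K, hK, rfl⟩, hlt⟩ := exists_lt_of_lt_csSup hne (sub_lt_self (sSup S) hε)
  refine ⟨K, hK, fun V hV hd => ?_⟩
  have := le_csSup hS ⟨K ⊔ V, by simpa using ⟨hK, hV⟩, rfl⟩
  rw [h.add K V hd] at this
  linarith

/-- Inside an arbitrary set `O`, a bounded charge is small off a suitable compact open set: one on
which the charge, and one on which its negative, almost attains its supremum. -/
theorem exists_abs_le_of_disjoint (h : IsBoundedCharge φ) (O : Set X) {ε : ℝ} (hε : 0 < ε) :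
    ∃ K : CompactOpens X, (K : Set X) ⊆ O ∧
      ∀ V : CompactOpens X, (V : Set X) ⊆ O → Disjoint K V → |φ V| ≤ ε := by
  obtain ⟨K, hK, h1⟩ := h.exists_le_of_disjoint O hε
  obtain ⟨K', hK', h2⟩ := h.neg.exists_le_of_disjoint O hε
  refine ⟨K ⊔ K', by simpa using ⟨hK, hK'⟩, fun V hV hd => abs_le.2 ⟨?_, ?_⟩⟩
  · have := h2 V hV (hd.mono_left le_sup_right)
    linarith
  · exact h1 V hV (hd.mono_left le_sup_left)

variable [T2Space X]

theorem inf_add_sdiff (h : IsBoundedCharge φ) (V W : CompactOpens X) :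
    φ V = φ (V ⊓ W) + φ (V \ W) := by
  rw [← h.add _ _ disjoint_inf_sdiff, sup_inf_sdiff]

theorem abs_sub_le (h : IsBoundedCharge φ) {G : Finset X} {ε : ℝ}
    (hG : ∀ V : CompactOpens X, (∀ z ∈ G, z ∉ V) → |φ V| ≤ ε) {V W : CompactOpens X}
    (hVW : ∀ z ∈ G, z ∈ V ↔ z ∈ W) : |φ V - φ W| ≤ 2 * ε := by
  have h1 := abs_le.1 (hG (V \ W) fun z hz hm => hm.2 ((hVW z hz).1 hm.1))
  have h2 := abs_le.1 (hG (W \ V) fun z hz hm => hm.2 ((hVW z hz).2 hm.1))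
  have h3 := h.inf_add_sdiff V W
  have h4 := h.inf_add_sdiff W V
  rw [inf_comm] at h4
  rw [abs_le]
  constructor <;> linarith [h1.1, h1.2, h2.1, h2.2]

end IsBoundedCharge

end FinitelyAdditive

/-! ### Spaces with the guessing property -/

/-- An uncountable linearly ordered space, locally compact and zero-dimensional, with countable
clopen initial segments, in which the following consequence of the club principle holds. Let
`R p q G` be a relation between points `p, q` and finite sets `G ∋ p, q` that is satisfied by triples
with `G` above any given point. Then there are triples `(p k, q k, G k)` satisfying `R` and a compact
open set `V` that meets `G k` in `{p k, q k}` for even `k` and in `{p k}` for odd `k`, such that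
`p k` for all `k`, and `q k` for even `k`, converge to a common limit. -/
class ClubSpace (X : Type*) [LinearOrder X] [TopologicalSpace X] : Prop extends T2Space X where
  uncountable : ¬ (univ : Set X).Countable
  countable_Iic : ∀ a : X, (Iic a).Countable
  isClopen_Iic : ∀ a : X, IsClopen (Iic a)
  exists_compactOpens : ∀ (x : X) (O : Set X), IsOpen O → x ∈ O →
    ∃ V : CompactOpens X, x ∈ V ∧ (V : Set X) ⊆ O
  countable_compactOpens : ∀ a : X, {V : CompactOpens X | (V : Set X) ⊆ Iic a}.Countable
  guess : ∀ R : X → X → Finset X → Prop, (∀ p q G, R p q G → p ∈ G ∧ q ∈ G) →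
    (∀ a, ∃ p q G, R p q G ∧ ∀ z ∈ G, a < z) →
    ∃ (l : X) (V : CompactOpens X) (p q : ℕ → X) (G : ℕ → Finset X),
      (∀ k, R (p k) (q k) (G k)) ∧
      (∀ k, ∀ z ∈ G k, z ∈ V ↔ z = p k ∨ Even k ∧ z = q k) ∧
      Tendsto p atTop (𝓝 l) ∧ Tendsto (fun k => q (2 * k)) atTop (𝓝 l)

namespace ClubSpace

variable {X : Type*} [LinearOrder X] [TopologicalSpace X] [ClubSpace X]

theorem exists_isGreatest {K : Set X} (hK : IsCompact K) (hne : K.Nonempty) :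
    ∃ a ∈ K, K ⊆ Iic a := by
  have : ClosedIciTopology X := ⟨fun a => by
    rw [← compl_Iio, isClosed_compl_iff]
    have : Iio a = ⋃ b ∈ Iio a, Iic b := by
      ext x
      simp only [mem_iUnion, mem_Iic, mem_Iio, exists_prop]
      exact ⟨fun h => ⟨x, h, le_rfl⟩, fun ⟨b, h1, h2⟩ => h2.trans_lt h1⟩
    rw [this]
    exact isOpen_biUnion fun b _ => (isClopen_Iic b).isOpen⟩
  obtain ⟨a, ha⟩ := hK.exists_isGreatest hne
  exact ⟨a, ha.1, ha.2⟩

theorem countable_of_isCompact {K : Set X} (hK : IsCompact K) : K.Countable := by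
  obtain rfl | hne := K.eq_empty_or_nonempty
  · exact countable_empty
  · obtain ⟨a, _, ha⟩ := exists_isGreatest hK hne
    exact (countable_Iic a).mono ha

theorem exists_gt_of_not_countable {s : Set X} (hs : ¬ s.Countable) (a : X) : ∃ x ∈ s, a < x := by
  by_contra! h
  exact hs ((countable_Iic a).mono h)

instance : LocallyCompactSpace X := by
  have : WeaklyLocallyCompactSpace X := ⟨fun x => by
    obtain ⟨V, hx, _⟩ := exists_compactOpens x univ isOpen_univ (mem_univ x)
    exact ⟨V, V.isCompact, V.isOpen.mem_nhds hx⟩⟩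
  infer_instance

theorem isScatteredSpace [WellFoundedLT X] : IsScatteredSpace X := by
  intro A hA
  refine ⟨wellFounded_lt.min A hA, wellFounded_lt.min_mem A hA, Iic (wellFounded_lt.min A hA),
    (isClopen_Iic _).isOpen, ?_⟩
  ext x
  refine ⟨fun ⟨h1, h2⟩ => ?_, fun h => ⟨?_, ?_⟩⟩
  · exact le_antisymm h1 (not_lt.1 (wellFounded_lt.not_lt_min A h2))
  · exact le_of_eq h
  · exact h ▸ wellFounded_lt.min_mem A hA

/-- If `X` were metrizable, then for some `n` there would be an uncountable set of points `x` with
`ball x (1 / (n + 1)) ⊆ Iic x`; the distances in such a set are bounded below, but `guess` provides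
a convergent sequence in it. -/
theorem not_metrizableSpace : ¬ TopologicalSpace.MetrizableSpace X := by
  intro _
  let _ := TopologicalSpace.metrizableSpaceMetric X
  have h1 : ∀ x : X, ∃ n : ℕ, Metric.ball x (1 / (n + 1)) ⊆ Iic x := by
    intro x
    obtain ⟨e, he, h⟩ := Metric.isOpen_iff.1 (isClopen_Iic x).isOpen x le_rfl
    obtain ⟨n, hn⟩ := exists_nat_one_div_lt he
    exact ⟨n, (Metric.ball_subset_ball hn.le).trans h⟩
  obtain ⟨n, hn⟩ : ∃ n : ℕ, ¬ {x : X | Metric.ball x (1 / ((n : ℝ) + 1)) ⊆ Iic x}.Countable := by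
    by_contra! h
    refine uncountable (X := X) ((countable_iUnion h).mono fun x _ => ?_)
    simpa using h1 x
  set s := {x : X | Metric.ball x (1 / ((n : ℝ) + 1)) ⊆ Iic x}
  obtain ⟨l, V, p, q, G, hR, -, hp, hq⟩ := guess (X := X)
    (fun p q G => p ∈ s ∧ q ∈ s ∧ p < q ∧ G = {p, q}) (by rintro p q G ⟨-, -, -, rfl⟩; simp) (by
      intro a
      obtain ⟨p, hp, hap⟩ := exists_gt_of_not_countable hn a
      obtain ⟨q, hq, hpq⟩ := exists_gt_of_not_countable hn p
      exact ⟨p, q, {p, q}, ⟨hp, hq, hpq, rfl⟩, by simpa using ⟨hap, hap.trans hpq⟩⟩)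
  have hp' : Tendsto (fun k => p (2 * k)) atTop (𝓝 l) :=
    hp.comp (tendsto_id.const_mul_atTop' two_pos)
  have h0 : Tendsto (fun k => dist (q (2 * k)) (p (2 * k))) atTop (𝓝 0) := by
    simpa using hq.dist hp'
  obtain ⟨k, hk⟩ := (h0.eventually_lt_const (u := 1 / ((n : ℝ) + 1)) (by positivity)).exists
  exact (hR (2 * k)).2.2.1.not_ge ((hR (2 * k)).1 hk)

end ClubSpace

/-! ### Atoms of bounded charges on a scattered space -/

namespace IsBoundedCharge

variable {X : Type*} [LinearOrder X] [TopologicalSpace X] [ClubSpace X]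
  {φ : CompactOpens X → ℝ}

theorem exists_finset_of_forall_mem (h : IsBoundedCharge φ) (O : Set X)
    (hO : ∀ a ∈ O, ∀ ε : ℝ, 0 < ε → ∃ G : Finset X, ∀ V : CompactOpens X, (V : Set X) ⊆ Iic a →
      (∀ z ∈ G, z ∉ V) → |φ V| ≤ ε) {ε : ℝ} (hε : 0 < ε) :
    ∃ G : Finset X, ∀ V : CompactOpens X, (V : Set X) ⊆ O → (∀ z ∈ G, z ∉ V) → |φ V| ≤ ε := by
  obtain ⟨K, hKO, hK⟩ := h.exists_abs_le_of_disjoint O (half_pos hε)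
  obtain hKe | hne := (K : Set X).eq_empty_or_nonempty
  · obtain rfl : K = ⊥ := CompactOpens.ext (by simpa using hKe)
    exact ⟨∅, fun V hV _ => (hK V hV disjoint_bot_left).trans (half_le_self hε.le)⟩
  obtain ⟨a, haK, ha⟩ := ClubSpace.exists_isGreatest K.isCompact hne
  obtain ⟨G, hG⟩ := hO a (hKO haK) _ (half_pos hε)
  refine ⟨G, fun V hV hVG => ?_⟩
  rw [h.inf_add_sdiff V K]
  have h1 := hG (V ⊓ K) (fun x hx => ha hx.2) fun z hz hm => hVG z hz hm.1
  have h2 := hK (V \ K) (fun x hx => hV hx.1) disjoint_sdiff_self_right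
  exact (abs_add_le _ _).trans (by linarith)

theorem exists_compactOpens_inter_finset (G : Finset X) {x : X} {O : Set X} (hO : IsOpen O)
    (hx : x ∈ O) : ∃ V : CompactOpens X, x ∈ V ∧ (V : Set X) ⊆ O ∧ ∀ z ∈ G, z ∈ V → z = x := by
  obtain ⟨V, hxV, hV⟩ := ClubSpace.exists_compactOpens x (O ∩ (↑(G.erase x) : Set X)ᶜ)
    (hO.inter (Finset.finite_toSet _).isClosed.isOpen_compl) ⟨hx, by simp⟩
  refine ⟨V, hxV, fun z hz => (hV hz).1, fun z hz hzV => ?_⟩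
  by_contra hne
  exact (hV hzV).2 (by simpa using ⟨hz, hne⟩)

variable [WellFoundedLT X]

/-- A bounded charge on `X` is carried by a finite set, up to `ε`. This is the form taken here by
the fact that Radon measures on scattered spaces are purely atomic. -/
theorem exists_finset (h : IsBoundedCharge φ) {ε : ℝ} (hε : 0 < ε) :
    ∃ G : Finset X, ∀ V : CompactOpens X, (∀ z ∈ G, z ∉ V) → |φ V| ≤ ε := by
  classical
  have key : ∀ a : X, ∀ ε : ℝ, 0 < ε → ∃ G : Finset X, ∀ V : CompactOpens X,
      (V : Set X) ⊆ Iic a → (∀ z ∈ G, z ∉ V) → |φ V| ≤ ε := by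
    intro a
    induction a using WellFoundedLT.induction with
    | ind a ih =>
    intro ε hε
    obtain ⟨G, hG⟩ := h.exists_finset_of_forall_mem (Iio a) ih hε
    refine ⟨insert a G, fun V hV hVG => hG V (fun x hx => ?_) fun z hz =>
      hVG z (Finset.mem_insert_of_mem hz)⟩
    refine lt_of_le_of_ne (hV hx) ?_
    rintro rfl
    exact hVG x (Finset.mem_insert_self _ _) hx
  obtain ⟨G, hG⟩ := h.exists_finset_of_forall_mem univ (fun a _ => key a) hε
  exact ⟨G, fun V => hG V (subset_univ _)⟩

/-- If a charge does not vanish on all sets avoiding `y`, then it has an atom `q ≠ y` of mass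
`w ≠ 0`, namely the least point of its support apart from `y`. -/
theorem exists_atom (h : IsBoundedCharge φ) {y : X} {V₀ : CompactOpens X} (hy : y ∉ V₀)
    (hV₀ : φ V₀ ≠ 0) : ∃ (q : X) (w : ℝ), q ≠ y ∧ w ≠ 0 ∧
      ∀ V : CompactOpens X, q ∈ V → (V : Set X) ⊆ Iic q → y ∉ V → φ V = w := by
  have hmax : ∀ V : CompactOpens X, φ V ≠ 0 → ∃ a ∈ V, (V : Set X) ⊆ Iic a := by
    intro V hV
    refine ClubSpace.exists_isGreatest V.isCompact (nonempty_iff_ne_empty.2 fun he => hV ?_)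
    rw [show V = ⊥ from CompactOpens.ext he, h.apply_bot]
  set S : Set X := {q | ∃ V : CompactOpens X, y ∉ V ∧ (V : Set X) ⊆ Iic q ∧ φ V ≠ 0}
  have hS : S.Nonempty := by
    obtain ⟨a, _, ha⟩ := hmax V₀ hV₀
    exact ⟨a, V₀, hy, ha, hV₀⟩
  obtain ⟨q, hq⟩ : ∃ q, q = wellFounded_lt.min S hS := ⟨_, rfl⟩
  have hzero : ∀ V : CompactOpens X, y ∉ V → (V : Set X) ⊆ Iio q → φ V = 0 := by
    intro V hyV hVq
    by_contra hne
    obtain ⟨a, haV, ha⟩ := hmax V hne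
    exact wellFounded_lt.not_lt_min S (x := a) ⟨V, hyV, ha, hne⟩ (hq ▸ hVq haV)
  obtain ⟨V₁, hy₁, hV₁q, hV₁⟩ : q ∈ S := hq ▸ wellFounded_lt.min_mem S hS
  have hqV₁ : q ∈ V₁ := by
    by_contra hn
    exact hV₁ (hzero V₁ hy₁ fun x hx => lt_of_le_of_ne (hV₁q hx) (by rintro rfl; exact hn hx))
  refine ⟨q, φ V₁, by rintro rfl; exact hy₁ hqV₁, hV₁, fun V hqV hVq hyV => ?_⟩
  have h1 : φ (V \ V₁) = 0 := hzero _ (fun hm => hyV hm.1) fun x hx =>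
    lt_of_le_of_ne (hVq hx.1) (by rintro rfl; exact hx.2 hqV₁)
  have h2 : φ (V₁ \ V) = 0 := hzero _ (fun hm => hy₁ hm.1) fun x hx =>
    lt_of_le_of_ne (hV₁q hx.1) (by rintro rfl; exact hx.2 hqV)
  rw [h.inf_add_sdiff V V₁, h.inf_add_sdiff V₁ V, h1, h2, inf_comm]

/-- If a charge does not vanish on all sets avoiding `y`, then a finite set `G` and rational
numbers witness that adding a suitable point `q` to a set containing `y` changes the charge. The
numbers are rational so that uncountably many charges share them. -/
theorem exists_witness (h : IsBoundedCharge φ) {y : X} {V₀ : CompactOpens X} (hy : y ∉ V₀)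
    (hV₀ : φ V₀ ≠ 0) : ∃ (ε r s : ℚ) (q : X) (G : Finset X), 2 * (ε : ℝ) < |(r : ℝ) - s| ∧
      y ∈ G ∧ q ∈ G ∧ (∃ W : CompactOpens X, (W : Set X) ⊆ Iic q ∧ φ W ≠ 0) ∧
      (∀ V : CompactOpens X, (∀ z ∈ G, z ∈ V ↔ z = y) → |φ V - r| ≤ ε) ∧
      (∀ V : CompactOpens X, (∀ z ∈ G, z ∈ V ↔ z = y ∨ z = q) → |φ V - s| ≤ ε) := by
  classical
  obtain ⟨q, w, hqy, hw, hqw⟩ := h.exists_atom hy hV₀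
  obtain ⟨δ, hδ⟩ : ∃ δ, δ = |w| / 10 := ⟨_, rfl⟩
  have hδ0 : 0 < δ := by rw [hδ]; positivity
  obtain ⟨G₀, hG₀⟩ := h.exists_finset hδ0
  set G := insert y (insert q G₀)
  have hG : ∀ V : CompactOpens X, (∀ z ∈ G, z ∉ V) → |φ V| ≤ δ := fun V hV =>
    hG₀ V fun z hz => hV z (Finset.mem_insert_of_mem (Finset.mem_insert_of_mem hz))
  have hyG : y ∈ G := Finset.mem_insert_self _ _
  have hqG : q ∈ G := Finset.mem_insert_of_mem (Finset.mem_insert_self _ _)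
  obtain ⟨Vy, hyVy, -, hVy⟩ := exists_compactOpens_inter_finset G isOpen_univ (mem_univ y)
  obtain ⟨Vq', hqVq', hVq'q, hVq'⟩ := exists_compactOpens_inter_finset G
    (ClubSpace.isClopen_Iic q).isOpen (le_refl q)
  set Vq := Vq' \ Vy
  have hqVq : q ∈ Vq := ⟨hqVq', fun hm => hqy (hVy q hqG hm)⟩
  have hVqq : (Vq : Set X) ⊆ Iic q := fun x hx => hVq'q hx.1
  have hVqw : φ Vq = w := hqw Vq hqVq hVqq fun hm => hm.2 hyVy
  have hsup : φ (Vy ⊔ Vq) = φ Vy + w := by rw [h.add _ _ disjoint_sdiff_self_right, hVqw]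
  obtain ⟨ε, hε1, hε2⟩ := exists_rat_btwn (show 3 * δ < 4 * δ by linarith)
  obtain ⟨r, hr1, hr2⟩ := exists_rat_btwn (show φ Vy < φ Vy + δ by linarith)
  obtain ⟨s, hs1, hs2⟩ := exists_rat_btwn (show φ Vy + w < φ Vy + w + δ by linarith)
  refine ⟨ε, r, s, q, G, ?_, hyG, hqG, ⟨Vq, hVqq, hVqw ▸ hw⟩, fun V hV => ?_, fun V hV => ?_⟩
  · rcases abs_cases w with ⟨h1, h2⟩ | ⟨h1, h2⟩ <;> rw [lt_abs]
    · right; linarith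
    · left; linarith
  · have := abs_le.1 (h.abs_sub_le hG (V := V) (W := Vy) fun z hz => (hV z hz).trans
      ⟨by rintro rfl; exact hyVy, hVy z hz⟩)
    rw [abs_le]; constructor <;> linarith [this.1, this.2]
  · have := abs_le.1 (h.abs_sub_le hG (V := V) (W := Vy ⊔ Vq) fun z hz => (hV z hz).trans
      ⟨by rintro (rfl | rfl); exacts [Or.inl hyVy, Or.inr hqVq],
        by rintro (hm | hm); exacts [Or.inl (hVy z hz hm), Or.inr (hVq' z hz hm.1)]⟩)
    rw [hsup] at this
    rw [abs_le]; constructor <;> linarith [this.1, this.2]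

end IsBoundedCharge

/-! ### Continuous families of charges -/

namespace ClubSpace

variable {X : Type*} [LinearOrder X] [TopologicalSpace X] [ClubSpace X]
  {τ : CompactOpens X → X → ℝ}

theorem countable_exists_ne_zero (hs : ∀ V, {y | τ V y ≠ 0}.Countable) (a : X) :
    {y | ∃ V : CompactOpens X, (V : Set X) ⊆ Iic a ∧ τ V y ≠ 0}.Countable := by
  refine ((countable_compactOpens a).biUnion fun V _ => hs V).mono ?_
  rintro y ⟨V, hV, hne⟩
  exact mem_biUnion (show V ∈ {V : CompactOpens X | (V : Set X) ⊆ Iic a} from hV) hne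

/-- If every `fun V => τ V y` is concentrated at `y`, with mass `c y`, then `c` is constant up to
countably many points. -/
theorem exists_const_of_concentrated (hc : ∀ V, Continuous (τ V)) {N : Set X} (hN : N.Countable)
    {c : X → ℝ} (h : ∀ y ∉ N, ∀ V, y ∈ V → τ V y = c y) : ∃ a, {y | c y ≠ a}.Countable := by
  have : CountableInterFilter (cocountable (α := X)) :=
    CardinalInterFilter.toCountableInterFilter _ Cardinal.aleph0_lt_aleph_one
  obtain ⟨a, ha⟩ := exists_eventuallyEq_const_of_forall_separating (l := cocountable (α := X))
    (f := c) (fun U => U ∈ range (Iio : ℝ → Set ℝ)) (by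
    rintro _ ⟨t, rfl⟩
    by_contra! hcon
    have hge' : ¬ {y | t ≤ c y}.Countable := fun hh =>
      hcon.1 (mem_cocountable.2 (hh.mono fun y hy => by simpa using hy))
    have hlt' : ¬ {y | c y < t}.Countable := fun hh =>
      hcon.2 (mem_cocountable.2 (hh.mono fun y hy => by simpa using hy))
    obtain ⟨n, hn⟩ : ∃ n : ℕ, ¬ {y | c y ≤ t - 1 / ((n : ℝ) + 1)}.Countable := by
      by_contra! hall
      refine hlt' ((countable_iUnion hall).mono fun y hy => ?_)
      obtain ⟨n, hn⟩ := exists_nat_one_div_lt (show 0 < t - c y from sub_pos.2 hy)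
      exact mem_iUnion.2 ⟨n, by simp only [mem_ofPred_eq]; linarith⟩
    have hdiff : ∀ s : Set X, ¬ s.Countable → ¬ (s \ N).Countable := fun s hs h' =>
      hs ((h'.union hN).mono (by rw [sdiff_union_self]; exact subset_union_left))
    obtain ⟨l, V, p, q, G, hR, hV, hp, hq⟩ := guess (X := X)
      (fun p q G => (t ≤ c p ∧ p ∉ N) ∧ (c q ≤ t - 1 / ((n : ℝ) + 1) ∧ q ∉ N) ∧ G = {p, q})
      (by rintro p q G ⟨-, -, rfl⟩; simp) (by
        intro a
        obtain ⟨p, hp, hap⟩ := exists_gt_of_not_countable (hdiff _ hge') a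
        obtain ⟨q, hq, haq⟩ := exists_gt_of_not_countable (hdiff _ hn) a
        exact ⟨p, q, {p, q}, ⟨hp, hq, rfl⟩, by simpa using ⟨hap, haq⟩⟩)
    have h1 : t ≤ τ V l := by
      refine ge_of_tendsto (((hc V).tendsto l).comp hp) (Eventually.of_forall fun k => ?_)
      have hm : p k ∈ V := (hV k (p k) (by rw [(hR k).2.2]; simp)).2 (Or.inl rfl)
      simpa [h (p k) (hR k).1.2 V hm] using (hR k).1.1
    have h2 : τ V l ≤ t - 1 / ((n : ℝ) + 1) := by
      refine le_of_tendsto (((hc V).tendsto l).comp hq) (Eventually.of_forall fun k => ?_)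
      have hm : q (2 * k) ∈ V :=
        (hV (2 * k) _ (by rw [(hR (2 * k)).2.2]; simp)).2 (Or.inr ⟨by simp, rfl⟩)
      simpa [h _ (hR (2 * k)).2.1.2 V hm] using (hR (2 * k)).2.1.1
    have : (0 : ℝ) < 1 / ((n : ℝ) + 1) := by positivity
    linarith)
  refine ⟨a, ?_⟩
  have := mem_cocountable.1 ha
  exact this

variable [WellFoundedLT X]

/-- For all but countably many `y`, the charge `fun V => τ V y` is concentrated at `y`. Otherwise
`guess`, applied to witnesses as in `IsBoundedCharge.exists_witness`, yields a compact open set `V`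
for which the function `τ V` has two distinct limits along a convergent sequence. -/
theorem countable_not_concentrated (hτ : ∀ y, IsBoundedCharge fun V => τ V y)
    (hc : ∀ V, Continuous (τ V)) (hs : ∀ V, {y | τ V y ≠ 0}.Countable) :
    {y | ∃ V, y ∉ V ∧ τ V y ≠ 0}.Countable := by
  classical
  by_contra hbad
  have hwit : ∀ y ∈ {y | ∃ V, y ∉ V ∧ τ V y ≠ 0}, _ := fun y hy =>
    (hτ y).exists_witness hy.choose_spec.1 hy.choose_spec.2
  obtain ⟨⟨ε, r, s⟩, hers⟩ : ∃ e : ℚ × ℚ × ℚ, ¬ {y | ∃ (q : X) (G : Finset X),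
      2 * (e.1 : ℝ) < |(e.2.1 : ℝ) - e.2.2| ∧
      y ∈ G ∧ q ∈ G ∧ (∃ W : CompactOpens X, (W : Set X) ⊆ Iic q ∧ τ W y ≠ 0) ∧
      (∀ V : CompactOpens X, (∀ z ∈ G, z ∈ V ↔ z = y) → |τ V y - e.2.1| ≤ e.1) ∧
      (∀ V : CompactOpens X, (∀ z ∈ G, z ∈ V ↔ z = y ∨ z = q) →
        |τ V y - e.2.2| ≤ e.1)}.Countable := by
    by_contra! hall
    refine hbad ((countable_iUnion hall).mono fun y hy => ?_)
    obtain ⟨ε, r, s, H⟩ := hwit y hy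
    exact mem_iUnion.2 ⟨(ε, r, s), H⟩
  dsimp only at hers
  obtain ⟨l, V, p, q, G, hR, hV, hp, -⟩ := guess (X := X)
    (fun p q G => 2 * (ε : ℝ) < |(r : ℝ) - s| ∧ p ∈ G ∧ q ∈ G ∧
      (∀ V : CompactOpens X, (∀ z ∈ G, z ∈ V ↔ z = p) → |τ V p - r| ≤ ε) ∧
      (∀ V : CompactOpens X, (∀ z ∈ G, z ∈ V ↔ z = p ∨ z = q) → |τ V p - s| ≤ ε))
    (fun p q G h => ⟨h.2.1, h.2.2.1⟩) (by
      intro a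
      have hun : ∀ S : Set X, ¬ S.Countable → ∃ y ∈ S,
          y ∉ ({y | ∃ V : CompactOpens X, (V : Set X) ⊆ Iic a ∧ τ V y ≠ 0} ∪
          Iic a) := by
        intro S hS
        by_contra! hsub
        exact hS (((countable_exists_ne_zero hs a).union (countable_Iic a)).mono hsub)
      obtain ⟨y, ⟨q, G, h1, hyG, hqG, ⟨W, hWq, hW⟩, hr, hs'⟩, hya⟩ := hun _ hers
      simp only [mem_union, mem_ofPred_eq, not_or, not_exists, not_and, not_not, mem_Iic,
        not_le] at hya
      have hqa : a < q := by
        by_contra hle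
        exact hW (hya.1 W (hWq.trans (Iic_subset_Iic.2 (not_lt.1 hle))))
      -- points of `G` up to `a` can be dropped, as the charge vanishes below `a`
      have hred : ∀ V : CompactOpens X, ∃ V' : CompactOpens X, τ V y = τ V' y ∧
          ∀ z, z ∈ V' ↔ z ∈ V ∧ a < z := by
        intro V
        let I : CompactOpens X := ⟨⟨V ∩ Iic a, V.isCompact.inter_right (isClopen_Iic a).isClosed⟩,
          V.isOpen.inter (isClopen_Iic a).isOpen⟩
        refine ⟨V \ I, ?_, fun z => ⟨fun hz => ⟨hz.1, not_le.1 fun hle => hz.2 ⟨hz.1, hle⟩⟩,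
          fun hz => ⟨hz.1, fun hm => not_le.2 hz.2 hm.2⟩⟩⟩
        have := (hτ y).inf_add_sdiff V I
        rwa [hya.1 (V ⊓ I) fun x hx => hx.2.2, zero_add] at this
      refine ⟨y, q, G.filter (a < ·), ⟨h1, by simpa using ⟨hyG, hya.2⟩,
        by simpa using ⟨hqG, hqa⟩, fun V hV => ?_, fun V hV => ?_⟩,
        fun z hz => (Finset.mem_filter.1 hz).2⟩
      · obtain ⟨V', hVV', hV'⟩ := hred V
        rw [hVV']
        refine hr V' fun z hz => ?_
        rw [hV']
        constructor
        · exact fun hm => (hV z (Finset.mem_filter.2 ⟨hz, hm.2⟩)).1 hm.1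
        · rintro rfl
          exact ⟨(hV z (Finset.mem_filter.2 ⟨hz, hya.2⟩)).2 rfl, hya.2⟩
      · obtain ⟨V', hVV', hV'⟩ := hred V
        rw [hVV']
        refine hs' V' fun z hz => ?_
        rw [hV']
        constructor
        · exact fun hm => (hV z (Finset.mem_filter.2 ⟨hz, hm.2⟩)).1 hm.1
        · intro hzz
          have haz : a < z := by rcases hzz with rfl | rfl; exacts [hya.2, hqa]
          exact ⟨(hV z (Finset.mem_filter.2 ⟨hz, haz⟩)).2 hzz, haz⟩)
  have hlim : Tendsto (fun k => τ V (p k)) atTop (𝓝 (τ V l)) := ((hc V).tendsto l).comp hp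
  have heven : |τ V l - s| ≤ ε := by
    refine le_of_tendsto (((hlim.comp
      (tendsto_id.const_mul_atTop' (r := 2) two_pos)).sub_const _).abs) (Eventually.of_forall ?_)
    exact fun k => (hR (2 * k)).2.2.2.2 V fun z hz => by simpa using hV (2 * k) z hz
  have hodd : |τ V l - r| ≤ ε := by
    refine le_of_tendsto (((hlim.comp ((tendsto_add_atTop_nat 1).comp
      (tendsto_id.const_mul_atTop' (r := 2) two_pos))).sub_const _).abs) (Eventually.of_forall ?_)
    exact fun k => (hR (2 * k + 1)).2.2.2.1 V fun z hz => by simpa using hV (2 * k + 1) z hz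
  have := abs_sub_le (r : ℝ) (τ V l) s
  rw [abs_sub_comm (r : ℝ) (τ V l)] at this
  linarith [(hR 0).1]

/-- The scalar case of the decomposition: up to countably many points, `τ` multiplies by a constant.
-/
theorem exists_const (hτ : ∀ y, IsBoundedCharge fun V => τ V y)
    (hc : ∀ V, Continuous (τ V)) (hs : ∀ V, {y | τ V y ≠ 0}.Countable) :
    ∃ (a : ℝ) (N : Set X), N.Countable ∧ ∀ y ∉ N, ∀ V : CompactOpens X,
      τ V y = (V : Set X).indicator (fun _ => a) y := by
  have hN := countable_not_concentrated hτ hc hs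
  set N := {y | ∃ V, y ∉ V ∧ τ V y ≠ 0}
  have hN0 : ∀ y ∉ N, ∀ V, y ∉ V → τ V y = 0 := fun y hy V hV => by
    by_contra hne
    exact hy ⟨V, hV, hne⟩
  choose U hU _ using fun y : X => exists_compactOpens y univ isOpen_univ (mem_univ y)
  have hNc : ∀ y ∉ N, ∀ V, y ∈ V → τ V y = τ (U y) y := by
    intro y hy V hV
    have h1 : τ V y = τ (V ⊓ U y) y + τ (V \ U y) y := (hτ y).inf_add_sdiff V (U y)
    have h2 : τ (U y) y = τ (U y ⊓ V) y + τ (U y \ V) y := (hτ y).inf_add_sdiff (U y) V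
    rw [hN0 y hy (V \ U y) fun hm => hm.2 (hU y), add_zero] at h1
    rw [hN0 y hy (U y \ V) fun hm => hm.2 hV, add_zero, inf_comm] at h2
    exact h1.trans h2.symm
  obtain ⟨a, ha⟩ := exists_const_of_concentrated hc hN hNc
  refine ⟨a, N ∪ {y | τ (U y) y ≠ a}, hN.union ha, fun y hy V => ?_⟩
  simp only [mem_union, not_or, mem_ofPred_eq, not_not] at hy
  by_cases hyV : y ∈ (V : Set X)
  · rw [indicator_of_mem hyV, hNc y hy.1 V hyV, hy.2]
  · rw [indicator_of_notMem hyV, hN0 y hy.1 V hyV]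

end ClubSpace

/-! ### Realization on `ω₁` under the club principle -/

section Guessing

variable {L : Type*} [LinearOrder L]

/-- Transfinite choice along a well-order in which countable sets are bounded above: each value
is chosen relative to a bound for all earlier values. -/
theorem exists_transfinite_choice [WellFoundedLT L] (hL : ∀ a : L, (Iic a).Countable)
    (hbdd : ∀ s : Set L, s.Countable → BddAbove s) {P : L → L → Prop} (hP : ∀ a, ∃ b, P a b) :
    ∃ c : L → L, ∀ a, ∃ g, (∀ b < a, c b ≤ g) ∧ P g (c a) := by
  have hub : ∀ (a : L) (f : ∀ b, b < a → L), ∃ g, ∀ b (hb : b < a), f b hb ≤ g := by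
    intro a f
    have : Countable {b // b < a} := ((hL a).mono Iio_subset_Iic_self).to_subtype
    obtain ⟨g, hg⟩ := hbdd _ (countable_range fun b : {b // b < a} => f b.1 b.2)
    exact ⟨g, fun b hb => hg ⟨⟨b, hb⟩, rfl⟩⟩
  choose g hg using hub
  choose F hF using hP
  refine ⟨(wellFounded_lt (α := L)).fix fun a ih => F (g a ih), fun a => ?_⟩
  rw [WellFounded.fix_eq]
  exact ⟨_, hg a _, hF _⟩

/-- The ladder system attached to sequences `e l` and a map `dec` by which each point of `L` codes
a triple `(p, q, G)`. A point `l` is a limit of the system if the sequence `e l` codes triples with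
`G` inside the successive intervals; selected are all `p`, and the `q` with even index. -/
@[reducible]
noncomputable def ladderOfCodes (lm : Set L) (e : L → ℕ → L)
    (he : ∀ l ∈ lm, StrictMono (e l) ∧ (∀ k, e l k < l) ∧ ∀ a < l, ∃ k, a < e l k)
    (dec : L → L × L × Finset L) : LadderSystem L where
  lim := {l | l ∈ lm ∧ ∀ k, ∀ z ∈ (dec (e l (k + 1))).2.2, z ∈ Ioc (e l k) (e l (k + 1))}
  bound := e
  block l k := (dec (e l (k + 1))).2.2
  sel l k := (dec (e l (k + 1))).2.2.filter fun z =>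
    z = (dec (e l (k + 1))).1 ∨ Even k ∧ z = (dec (e l (k + 1))).2.1
  strictMono l hl := (he l hl.1).1
  bound_lt l hl := (he l hl.1).2.1
  cofinal l hl := (he l hl.1).2.2
  sel_subset _ _ := Finset.filter_subset _ _
  block_mem _ hl := hl.2

attribute [local instance] LadderSystem.topology

/-- The topology of `ladderOfCodes` makes `L` a `ClubSpace`, if the sequences `e l` guess
uncountable sets and each triple has arbitrarily large codes. -/
theorem clubSpace_ladderOfCodes [WellFoundedLT L] (hun : ¬ (univ : Set L).Countable)
    (hL : ∀ a : L, (Iic a).Countable) (lm : Set L) (e : L → ℕ → L)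
    (he : ∀ l ∈ lm, StrictMono (e l) ∧ (∀ k, e l k < l) ∧ ∀ a < l, ∃ k, a < e l k)
    (hclub : ∀ s : Set L, ¬ s.Countable → ∃ l ∈ lm, range (e l) ⊆ s)
    (dec : L → L × L × Finset L) (hdec : ∀ t a, ∃ b, a < b ∧ dec b = t) :
    let _ := ladderOfCodes lm e he dec
    ClubSpace L := by
  intro _
  have hbdd : ∀ s : Set L, s.Countable → BddAbove s := by
    intro s hs
    by_contra hb
    refine hun ((hs.biUnion fun x _ => hL x).mono fun a _ => ?_)
    obtain ⟨x, hx, hax⟩ := not_bddAbove_iff.1 hb a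
    exact mem_biUnion hx hax.le
  refine ⟨hun, hL, LadderSystem.isClopen_Iic, fun x O hO hx => ?_,
    LadderSystem.countable_compactOpens hL, fun R hRG hR => ?_⟩
  · obtain ⟨o, _, h1, h2⟩ := LadderSystem.exists_basicOpen hO hx
    exact ⟨_, h1, h2⟩
  -- an uncountable set of codes, such that each code lies below the finite sets coded later
  obtain ⟨c, hc⟩ := exists_transfinite_choice hL hbdd (P := fun g b => g < b ∧
      R (dec b).1 (dec b).2.1 (dec b).2.2 ∧ ∀ z ∈ (dec b).2.2, z ∈ Ioc g b) (by
    intro a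
    obtain ⟨p, q, G, hpq, hG⟩ := hR a
    obtain ⟨u, hu⟩ := hbdd _ ((countable_singleton a).union G.countable_toSet)
    obtain ⟨b, hub, hb⟩ := hdec (p, q, G) u
    refine ⟨b, (hu (Or.inl rfl)).trans_lt hub, ?_⟩
    rw [hb]
    exact ⟨hpq, fun z hz => ⟨hG z hz, (hu (Or.inr hz)).trans hub.le⟩⟩)
  have hmono : StrictMono c := fun b a hba => by
    obtain ⟨g, hg, hlt, -⟩ := hc a
    exact (hg b hba).trans_lt hlt
  obtain ⟨l, hl, hlc⟩ := hclub (range c) fun h =>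
    hun (by simpa using h.preimage_of_injOn (f := c) hmono.injective.injOn)
  have hkey : ∀ k, R (dec (e l (k + 1))).1 (dec (e l (k + 1))).2.1 (dec (e l (k + 1))).2.2 ∧
      ∀ z ∈ (dec (e l (k + 1))).2.2, z ∈ Ioc (e l k) (e l (k + 1)) := by
    intro k
    obtain ⟨b, hb⟩ := hlc ⟨k, rfl⟩
    obtain ⟨a, ha⟩ := hlc ⟨k + 1, rfl⟩
    obtain ⟨g, hg, -, h1, h2⟩ := hc a
    have hba : b < a := hmono.lt_iff_lt.1 (by rw [hb, ha]; exact (he l hl).1 (Nat.lt_succ_self k))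
    rw [← ha, ← hb]
    exact ⟨h1, fun z hz => ⟨(hg b hba).trans_lt (h2 z hz).1, (h2 z hz).2⟩⟩
  have hlim : l ∈ LadderSystem.lim (L := L) := ⟨hl, fun k => (hkey k).2⟩
  have hmem : ∀ k, ∀ z ∈ (dec (e l (k + 1))).2.2, z ∈ LadderSystem.nbhd l ↔
      z = (dec (e l (k + 1))).1 ∨ Even k ∧ z = (dec (e l (k + 1))).2.1 := fun k z hz =>
    (LadderSystem.mem_nbhd_iff_mem_sel hlim hz).trans
      (Finset.mem_filter.trans ⟨fun h => h.2, fun h => ⟨hz, h⟩⟩)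
  have hpG := fun k => hRG _ _ _ (hkey k).1
  refine ⟨l, LadderSystem.basicOpen l none, fun k => (dec (e l (k + 1))).1,
    fun k => (dec (e l (k + 1))).2.1, fun k => (dec (e l (k + 1))).2.2, fun k => (hkey k).1,
    fun k z hz => ?_, ?_, ?_⟩
  · rw [← hmem k z hz]
    exact ⟨fun h => h.1, fun h => ⟨h, by simp⟩⟩
  · exact LadderSystem.tendsto_of_mem_nbhd hlim
      (fun k => (hmem k _ (hpG k).1).2 (Or.inl rfl)) fun k => ((hkey k).2 _ (hpG k).1).1
  · refine LadderSystem.tendsto_of_mem_nbhd hlim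
      (fun k => (hmem _ _ (hpG (2 * k)).2).2 (Or.inr ⟨by simp, rfl⟩)) fun k => ?_
    exact ((he l hl).1.monotone (by omega)).trans_lt ((hkey (2 * k)).2 _ (hpG (2 * k)).2).1

end Guessing

/-- Every set of size `ℵ₁` codes the triples `(p, q, G)`, with `ℵ₁` codes for each triple. -/
theorem exists_decoding {L : Type*} [LinearOrder L] (hun : ¬ (univ : Set L).Countable)
    (hL : ∀ a : L, (Iic a).Countable) :
    ∃ dec : L → L × L × Finset L, ∀ t a, ∃ b, a < b ∧ dec b = t := by
  have : Infinite L := by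
    by_contra hfin
    rw [not_infinite_iff_finite] at hfin
    exact hun (to_countable _)
  have hcard : Cardinal.mk L = Cardinal.mk ((L × L × Finset L) × L) := by
    simp [Cardinal.mul_eq_self (Cardinal.aleph0_le_mk L)]
  obtain ⟨f⟩ := Cardinal.eq.1 hcard
  refine ⟨fun b => (f b).1, fun t a => ?_⟩
  by_contra! h
  refine hun (((hL a).preimage_of_injOn (f := fun x => f.symm (t, x)) ?_).mono fun x _ => ?_)
  · intro x _ y _ hxy
    simpa using hxy
  · exact not_lt.1 fun hlt => h _ hlt (by simp)

/-- The club principle, transported to the type `ω₁`. -/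
theorem OstaszewskiClub.toType (club : OstaszewskiClub) :
    ∃ (lm : Set (Ordinal.omega.{0} 1).ToType)
      (e : (Ordinal.omega.{0} 1).ToType → ℕ → (Ordinal.omega.{0} 1).ToType),
      (∀ l ∈ lm, StrictMono (e l) ∧ (∀ k, e l k < l) ∧ ∀ a < l, ∃ k, a < e l k) ∧
      ∀ s : Set (Ordinal.omega.{0} 1).ToType, ¬ s.Countable → ∃ l ∈ lm, range (e l) ⊆ s := by
  obtain ⟨S, hS, hclub⟩ := club
  let i : Iio (Ordinal.omega.{0} 1) ≃o (Ordinal.omega.{0} 1).ToType := Ordinal.ToType.mk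
  have h1 : ∀ l : (Ordinal.omega.{0} 1).ToType, Order.IsSuccLimit (i.symm l).1 →
      ∃ e : ℕ → (Ordinal.omega.{0} 1).ToType, StrictMono e ∧ ∀ a : (Ordinal.omega.{0} 1).ToType,
        a ∈ range e ↔ (i.symm a).1 ∈ S (i.symm l).1 := by
    intro l hl
    obtain ⟨⟨e, he, hSe⟩, hlt, -⟩ := hS _ (i.symm l).2 hl
    have hlt' : ∀ k, e k < Ordinal.omega.{0} 1 := fun k =>
      (show e k < (i.symm l).1 from hlt (hSe ▸ mem_range_self k)).trans (i.symm l).2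
    refine ⟨fun k => i ⟨e k, hlt' k⟩, fun k m hkm => i.strictMono (he hkm), fun a => ?_⟩
    rw [hSe]
    constructor
    · rintro ⟨k, rfl⟩
      exact ⟨k, by simp⟩
    · rintro ⟨k, hk⟩
      exact ⟨k, by simp [hk]⟩
  have : Nonempty (Ordinal.omega.{0} 1).ToType := ⟨i ⟨0, Ordinal.omega_pos 1⟩⟩
  choose! e he hrange using h1
  refine ⟨{l | Order.IsSuccLimit (i.symm l).1}, e, fun l hl => ⟨he l hl, fun k => ?_,
    fun a ha => ?_⟩, fun s hs => ?_⟩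
  · have := (hS _ (i.symm l).2 hl).2.1 ((hrange l hl _).1 ⟨k, rfl⟩)
    exact i.symm.lt_iff_lt.1 this
  · obtain ⟨b, hb, hab⟩ := (hS _ (i.symm l).2 hl).2.2 (i.symm a).1 (i.symm.lt_iff_lt.2 ha)
    have hb' : b < Ordinal.omega.{0} 1 :=
      (show b < (i.symm l).1 from (hS _ (i.symm l).2 hl).2.1 hb).trans (i.symm l).2
    obtain ⟨k, hk⟩ := (hrange l hl (i ⟨b, hb'⟩)).2 (by simpa using hb)
    refine ⟨k, ?_⟩
    rw [hk, ← i.symm.lt_iff_lt]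
    simpa using (show (i.symm a) < ⟨b, hb'⟩ from hab)
  · obtain ⟨l, hl, hlim, hlS⟩ := hclub ((fun a => (i.symm a).1) '' s)
      (by rintro _ ⟨a, -, rfl⟩; exact (i.symm a).2)
      (fun h => hs ((h.preimage_of_injOn (f := fun a => (i.symm a).1)
        (Subtype.val_injective.comp i.symm.injective).injOn).mono (subset_preimage_image _ _)))
    have hl' : Order.IsSuccLimit (i.symm (i ⟨l, hl⟩)).1 := by simpa using hlim
    refine ⟨i ⟨l, hl⟩, hl', fun a ha => ?_⟩
    have := (hrange _ hl' a).1 ha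
    simp only [OrderIso.symm_apply_apply] at this
    obtain ⟨b, hb, hba⟩ := hlS this
    rwa [i.symm.injective (Subtype.val_injective hba)] at hb

theorem countable_Iio_of_lt_omega_one {a : Ordinal.{0}} (ha : a < Ordinal.omega 1) :
    (Iio a).Countable := by
  rw [← Cardinal.le_aleph0_iff_set_countable, Cardinal.mk_Iio_ordinal, Cardinal.lift_le_aleph0,
    ← Cardinal.lt_aleph_one_iff, ← Cardinal.lt_ord]
  simpa using ha

theorem countable_Iic_omega_one (a : (Ordinal.omega.{0} 1).ToType) : (Iic a).Countable := by
  have h := countable_Iio_of_lt_omega_one (mem_Iio.1 (Ordinal.ToType.mk.symm a).2)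
  refine (((h.insert (Ordinal.ToType.mk.symm a).1).preimage_of_injOn
    (f := fun b : (Ordinal.omega.{0} 1).ToType => (Ordinal.ToType.mk.symm b).1)
    (Subtype.val_injective.comp Ordinal.ToType.mk.symm.injective).injOn)).mono fun b hb => ?_
  obtain rfl | hlt := eq_or_lt_of_le (show b ≤ a from hb)
  · exact Or.inl rfl
  · exact Or.inr (Ordinal.ToType.mk.symm.lt_iff_lt.2 hlt)

theorem not_countable_omega_one : ¬ (univ : Set (Ordinal.omega.{0} 1).ToType).Countable := by
  rw [countable_univ_iff, ← Cardinal.mk_le_aleph0_iff]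
  simp

/-- The club principle provides a `ClubSpace`, with underlying set `ω₁`. -/
theorem OstaszewskiClub.exists_clubSpace (club : OstaszewskiClub) :
    ∃ (L : Type) (_ : LinearOrder L) (_ : WellFoundedLT L) (_ : TopologicalSpace L),
      ClubSpace L := by
  obtain ⟨lm, e, he, hclub⟩ := club.toType
  obtain ⟨dec, hdec⟩ := exists_decoding not_countable_omega_one countable_Iic_omega_one
  exact ⟨_, inferInstance, inferInstance, _, clubSpace_ladderOfCodes not_countable_omega_one
    countable_Iic_omega_one lm e he hclub dec hdec⟩

/-! ### Density of indicator functions -/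

section Indicators

variable {X : Type*} [TopologicalSpace X]

/-- Evaluation at a point, as a bounded functional. -/
noncomputable def C0Eval (x : X) : C₀(X, ℝ) →L[ℝ] ℝ :=
  LinearMap.mkContinuous
    { toFun := fun f => f x
      map_add' := fun _ _ => rfl
      map_smul' := fun _ _ => rfl } 1 fun f => by
    rw [one_mul]
    exact C0_norm_coe_le f x

theorem C0_continuous_eval (x : X) : Continuous fun f : C₀(X, ℝ) => f x := (C0Eval x).continuous

variable [T2Space X]

/-- The indicator function of a compact open set, as an element of `C₀`. -/
noncomputable def C0Ind (V : CompactOpens X) : C₀(X, ℝ) where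
  toFun := (V : Set X).indicator fun _ => 1
  continuous_toFun := continuous_const.indicator (by
    simp [IsClopen.frontier_eq ⟨V.isCompact.isClosed, V.isOpen⟩])
  zero_at_infty' := by
    refine tendsto_const_nhds.congr' ?_
    filter_upwards [V.isCompact.compl_mem_cocompact] with x hx
    exact (indicator_of_notMem hx _).symm

theorem C0Ind_apply (V : CompactOpens X) (x : X) :
    C0Ind V x = (V : Set X).indicator (fun _ => (1 : ℝ)) x := rfl

theorem C0Ind_of_mem {V : CompactOpens X} {x : X} (h : x ∈ V) : C0Ind V x = 1 :=
  indicator_of_mem (s := (V : Set X)) h fun _ => (1 : ℝ)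

theorem C0Ind_of_notMem {V : CompactOpens X} {x : X} (h : x ∉ V) : C0Ind V x = 0 :=
  indicator_of_notMem (s := (V : Set X)) h fun _ => (1 : ℝ)

theorem norm_C0Ind_le (V : CompactOpens X) : ‖C0Ind V‖ ≤ 1 :=
  C0_norm_le _ zero_le_one fun x => by
    by_cases h : x ∈ V
    · simp [C0Ind_of_mem h]
    · simp [C0Ind_of_notMem h]

theorem C0Ind_bot : C0Ind (⊥ : CompactOpens X) = 0 := by
  ext x
  exact C0Ind_of_notMem (V := ⊥) (notMem_empty x)

theorem C0Ind_mul (V W : CompactOpens X) : C0Ind V * C0Ind W = C0Ind (V ⊓ W) := by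
  ext x
  simp only [ZeroAtInftyContinuousMap.mul_apply]
  by_cases hV : x ∈ V <;> by_cases hW : x ∈ W
  · rw [C0Ind_of_mem hV, C0Ind_of_mem hW, C0Ind_of_mem (V := V ⊓ W) ⟨hV, hW⟩, mul_one]
  · rw [C0Ind_of_notMem hW, C0Ind_of_notMem (V := V ⊓ W) fun h => hW h.2, mul_zero]
  · rw [C0Ind_of_notMem hV, C0Ind_of_notMem (V := V ⊓ W) fun h => hV h.1, zero_mul]
  · rw [C0Ind_of_notMem hV, C0Ind_of_notMem (V := V ⊓ W) fun h => hV h.1, zero_mul]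

theorem C0Ind_sup_of_disjoint {V W : CompactOpens X} (h : Disjoint V W) :
    C0Ind (V ⊔ W) = C0Ind V + C0Ind W := by
  have hd : Disjoint (V : Set X) W := by
    rw [Set.disjoint_iff_inter_eq_empty, ← CompactOpens.coe_inf, h.eq_bot, CompactOpens.coe_bot]
  ext x
  exact congrFun (indicator_union_of_disjoint hd fun _ => (1 : ℝ)) x

theorem C0Ind_sdiff (V W : CompactOpens X) : C0Ind (V \ W) = C0Ind V - C0Ind V * C0Ind W := by
  rw [eq_sub_iff_add_eq', C0Ind_mul, ← C0Ind_sup_of_disjoint disjoint_inf_sdiff, sup_inf_sdiff]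

/-- A subalgebra of `C₀` approximates `f` if it contains the indicator functions of arbitrarily
small neighbourhoods of every point at which `f` does not vanish. -/
theorem C0_mem_closure_of_C0Ind_mem (S : NonUnitalSubalgebra ℝ C₀(X, ℝ)) (f : C₀(X, ℝ))
    (h : ∀ x, f x ≠ 0 → ∀ O, IsOpen O → x ∈ O →
      ∃ V : CompactOpens X, x ∈ V ∧ (V : Set X) ⊆ O ∧ C0Ind V ∈ S) :
    f ∈ closure (S : Set C₀(X, ℝ)) := by
  rw [Metric.mem_closure_iff]
  intro ε hε
  obtain ⟨K₀, hK₀, hf⟩ := C0_exists_compact f (half_pos hε)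
  have hK : IsCompact (K₀ ∩ {x | ε / 2 ≤ |f x|}) :=
    hK₀.inter_right (isClosed_le continuous_const f.continuous.abs)
  obtain ⟨V, -, hKV, e, heS, heV, heV'⟩ : ∃ V : CompactOpens X, C0Ind V ∈ S ∧
      (K₀ ∩ {x | ε / 2 ≤ |f x|}) ⊆ V ∧
      ∃ e ∈ S, (∀ x ∈ V, |f x - e x| ≤ ε / 2) ∧ ∀ x ∉ V, e x = 0 := by
    refine hK.induction_on (p := fun s => ∃ V : CompactOpens X, C0Ind V ∈ S ∧ s ⊆ V ∧
      ∃ e ∈ S, (∀ x ∈ V, |f x - e x| ≤ ε / 2) ∧ ∀ x ∉ V, e x = 0) ?_ ?_ ?_ ?_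
    · refine ⟨⊥, by rw [C0Ind_bot]; exact S.zero_mem, empty_subset _, 0, S.zero_mem,
        fun x hx => absurd hx (notMem_empty x), fun _ _ => rfl⟩
    · rintro s t hst ⟨V, hV, htV, H⟩
      exact ⟨V, hV, hst.trans htV, H⟩
    · rintro s t ⟨V, hV, hsV, e, he, heV, heV'⟩ ⟨W, hW, htW, e', he', heW, heW'⟩
      refine ⟨V ⊔ W, ?_, union_subset_union hsV htW, e + e' - C0Ind V * e',
        sub_mem (add_mem he he') (mul_mem hV he'), fun x hx => ?_, fun x hx => ?_⟩
      · rw [← sup_sdiff_self_right, C0Ind_sup_of_disjoint disjoint_sdiff_self_right]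
        refine add_mem hV ?_
        rw [C0Ind_sdiff]
        exact sub_mem hW (mul_mem hW hV)
      · simp only [ZeroAtInftyContinuousMap.sub_apply, ZeroAtInftyContinuousMap.add_apply,
          ZeroAtInftyContinuousMap.mul_apply]
        by_cases hxV : x ∈ V
        · simpa [C0Ind_of_mem hxV] using heV x hxV
        · have hxW : x ∈ W := hx.resolve_left hxV
          simpa [C0Ind_of_notMem hxV, heV' x hxV] using heW x hxW
      · have hxV : x ∉ V := fun hm => hx (Or.inl hm)
        have hxW : x ∉ W := fun hm => hx (Or.inr hm)
        simp [heV' x hxV, heW' x hxW]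
    · intro x hx
      have hfx : f x ≠ 0 := fun h0 => by
        have := hx.2
        simp only [mem_ofPred_eq, h0, abs_zero] at this
        linarith
      obtain ⟨V, hxV, hVO, hV⟩ := h x hfx {y | |f y - f x| < ε / 2}
        (isOpen_lt (by have := f.continuous; fun_prop) continuous_const) (by simpa using hε)
      refine ⟨V, mem_nhdsWithin_of_mem_nhds (V.isOpen.mem_nhds hxV), V, hV, Subset.rfl,
        f x • C0Ind V, SMulMemClass.smul_mem _ hV, fun y hy => ?_, fun y hy => ?_⟩
      · simpa [C0Ind_of_mem hy] using (show |f y - f x| < ε / 2 from hVO hy).le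
      · simp [C0Ind_of_notMem hy]
  refine ⟨e, heS, ?_⟩
  rw [dist_eq_norm]
  refine lt_of_le_of_lt (C0_norm_le _ (half_pos hε).le fun x => ?_) (half_lt_self hε)
  simp only [ZeroAtInftyContinuousMap.sub_apply]
  by_cases hxV : x ∈ V
  · exact heV x hxV
  · rw [heV' x hxV, sub_zero]
    by_contra! hlt
    refine hxV (hKV ⟨?_, hlt.le⟩)
    by_contra hxK
    exact lt_asymm hlt (hf x hxK)

end Indicators

/-! ### Boxes in products with an ordinal -/

/-- The compact open initial segment `[0, v]` of the ordinal space `[0, a)`. -/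
def ordinalIic {a : Ordinal.{0}} (v : OrdinalSpace a) : CompactOpens (OrdinalSpace a) where
  carrier := Iic v
  isCompact' := by
    rw [Subtype.isCompact_iff]
    have : Subtype.val '' (Iic v) = Icc 0 v.1 := by
      ext x
      constructor
      · rintro ⟨y, hy, rfl⟩
        exact ⟨zero_le, hy⟩
      · rintro ⟨-, hx⟩
        exact ⟨⟨x, lt_of_le_of_lt hx v.2⟩, hx, rfl⟩
    rw [this]
    exact isCompact_Icc
  isOpen' := by
    have : Iic v = Subtype.val ⁻¹' Iio (Order.succ v.1) := by
      ext x
      exact (Order.lt_succ_iff (a := x.1) (b := v.1)).symm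
    rw [this]
    exact isOpen_Iio.preimage continuous_subtype_val

section Boxes

variable {a : Ordinal.{0}} {L : Type*} [TopologicalSpace L] [T2Space L]

/-- The indicator function of the box `[0, v] × W`. -/
noncomputable def boxInd (v : OrdinalSpace a) (W : CompactOpens L) : C₀(OrdinalSpace a × L, ℝ) :=
  C0Ind (ordinalIic v ×ˢ W)

theorem boxInd_mul (v v' : OrdinalSpace a) (W W' : CompactOpens L) :
    boxInd v W * boxInd v' W' = boxInd (min v v') (W ⊓ W') := by
  rw [boxInd, boxInd, C0Ind_mul, boxInd]
  congr 1
  apply CompactOpens.ext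
  rw [CompactOpens.coe_inf, CompactOpens.coe_prod, CompactOpens.coe_prod, CompactOpens.coe_prod,
    prod_inter_prod, CompactOpens.coe_inf]
  congr 1
  exact Iic_inter_Iic

theorem boxInd_sup_of_disjoint (v : OrdinalSpace a) {W W' : CompactOpens L} (h : Disjoint W W') :
    boxInd v (W ⊔ W') = boxInd v W + boxInd v W' := by
  rw [boxInd, boxInd, boxInd, ← C0Ind_sup_of_disjoint]
  · congr 1
    apply CompactOpens.ext
    simp [prod_union]
  · rw [disjoint_iff_inf_le]
    rintro ⟨x, y⟩ ⟨h1, h2⟩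
    exact disjoint_iff_inf_le.1 h ⟨h1.2, h2.2⟩

/-- Functions on `[0, a) × L` that vanish off an open set `P` of fibres are limits of linear
combinations of indicator functions of boxes `[0, v] × W` with `W ⊆ P`. -/
theorem mem_closure_span_boxInd
    (hL : ∀ (y : L) (O : Set L), IsOpen O → y ∈ O → ∃ W : CompactOpens L, y ∈ W ∧ (W : Set L) ⊆ O)
    {P : Set L} (hP : IsOpen P) (f : C₀(OrdinalSpace a × L, ℝ))
    (hf : ∀ x y, f (x, y) ≠ 0 → y ∈ P) :
    f ∈ closure (Submodule.span ℝ {g | ∃ (v : OrdinalSpace a) (W : CompactOpens L),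
      (W : Set L) ⊆ P ∧ boxInd v W = g} : Set C₀(OrdinalSpace a × L, ℝ)) := by
  let F : Subsemigroup C₀(OrdinalSpace a × L, ℝ) :=
    { carrier := {g | ∃ (v : OrdinalSpace a) (W : CompactOpens L), (W : Set L) ⊆ P ∧
        boxInd v W = g}
      mul_mem' := by
        rintro _ _ ⟨v, W, hW, rfl⟩ ⟨v', W', hW', rfl⟩
        exact ⟨_, W ⊓ W', inter_subset_left.trans hW, (boxInd_mul v v' W W').symm⟩ }
  have hspan : (Submodule.span ℝ (F : Set C₀(OrdinalSpace a × L, ℝ)) :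
      Set C₀(OrdinalSpace a × L, ℝ)) =
      (NonUnitalAlgebra.adjoin ℝ (F : Set C₀(OrdinalSpace a × L, ℝ)) : Set _) := by
    have := NonUnitalAlgebra.adjoin_eq_span (R := ℝ) (F : Set C₀(OrdinalSpace a × L, ℝ))
    rw [Subsemigroup.closure_eq] at this
    rw [← this]
    rfl
  change f ∈ closure (Submodule.span ℝ (F : Set C₀(OrdinalSpace a × L, ℝ)) : Set _)
  rw [hspan]
  refine C0_mem_closure_of_C0Ind_mem _ f ?_
  rintro ⟨x, y⟩ hxy O hO hxyO
  have hmem : ∀ v (W : CompactOpens L), (W : Set L) ⊆ P →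
      boxInd v W ∈ NonUnitalAlgebra.adjoin ℝ (F : Set C₀(OrdinalSpace a × L, ℝ)) :=
    fun v W hW => NonUnitalAlgebra.subset_adjoin ℝ ⟨v, W, hW, rfl⟩
  obtain ⟨u, w, hu, hw, hxu, hyw, huw⟩ := isOpen_prod_iff.1 hO x y hxyO
  obtain ⟨W, hyW, hW⟩ := hL y (w ∩ P) (hw.inter hP) ⟨hyw, hf x y hxy⟩
  by_cases hmin : ∃ m, m < x
  · obtain ⟨m, hm, hmu⟩ := exists_Ioc_subset_of_mem_nhds (hu.mem_nhds hxu) hmin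
    refine ⟨(ordinalIic x ×ˢ W) \ (ordinalIic m ×ˢ W), ⟨⟨le_refl x, hyW⟩, fun h => ?_⟩, ?_, ?_⟩
    · exact absurd (show x ≤ m from h.1) (not_le.2 hm)
    · rintro ⟨x', y'⟩ ⟨⟨h1, h2⟩, h3⟩
      exact huw ⟨hmu ⟨not_le.1 fun h => h3 ⟨h, h2⟩, h1⟩, (hW h2).1⟩
    · rw [C0Ind_sdiff]
      have hWP : (W : Set L) ⊆ P := fun z hz => (hW hz).2
      exact sub_mem (hmem x W hWP) (mul_mem (hmem x W hWP) (hmem m W hWP))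
  · push Not at hmin
    refine ⟨ordinalIic x ×ˢ W, ⟨le_refl x, hyW⟩, ?_, hmem x W fun z hz => (hW hz).2⟩
    rintro ⟨x', y'⟩ ⟨h1, h2⟩
    obtain rfl : x' = x := le_antisymm h1 (hmin x')
    exact huw ⟨hxu, (hW h2).1⟩

/-- Extending functions on `[0, a)` to `[0, a) × L`, constantly along `W` and by zero off `W`. -/
noncomputable def tensorInd (W : CompactOpens L) :
    C₀(OrdinalSpace a, ℝ) →L[ℝ] C₀(OrdinalSpace a × L, ℝ) :=
  LinearMap.mkContinuous
    { toFun := fun g =>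
        { toFun := fun p => (W : Set L).indicator (fun _ => (1 : ℝ)) p.2 * g p.1
          continuous_toFun := ((C0Ind W).continuous.comp continuous_snd).mul
            (g.continuous.comp continuous_fst)
          zero_at_infty' := by
            rw [Metric.tendsto_nhds]
            intro e he
            obtain ⟨K, hK, h⟩ := C0_exists_compact g he
            refine mem_cocompact.2 ⟨K ×ˢ W, hK.prod W.isCompact, fun p hp => ?_⟩
            by_cases hW : p.2 ∈ (W : Set L)
            · simpa [hW] using h p.1 fun hm => hp ⟨hm, hW⟩
            · simpa [hW] using he }
      map_add' := fun f g => by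
        ext p
        exact mul_add _ _ _
      map_smul' := fun c f => by
        ext p
        exact mul_left_comm _ _ _ } 1 fun g => C0_norm_le _ (by positivity) fun p => by
    change |(W : Set L).indicator (fun _ => (1 : ℝ)) p.2 * g p.1| ≤ 1 * ‖g‖
    by_cases hW : p.2 ∈ (W : Set L)
    · simpa [hW] using C0_norm_coe_le g p.1
    · simp [hW]

theorem tensorInd_apply (W : CompactOpens L) (g : C₀(OrdinalSpace a, ℝ)) (x : OrdinalSpace a)
    (y : L) : tensorInd W g (x, y) = (W : Set L).indicator (fun _ => (1 : ℝ)) y * g x := rfl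

theorem tensorInd_C0Ind (v : OrdinalSpace a) (W : CompactOpens L) :
    tensorInd W (C0Ind (ordinalIic v)) = boxInd v W := by
  ext ⟨x, y⟩
  rw [tensorInd_apply, boxInd, C0Ind_apply, C0Ind_apply, CompactOpens.coe_prod]
  by_cases hx : x ∈ (ordinalIic v : Set (OrdinalSpace a)) <;> by_cases hy : y ∈ (W : Set L) <;>
    simp [hx, hy]

theorem fibre_tensorInd {W : CompactOpens L} {y : L} (hy : y ∈ W) (g : C₀(OrdinalSpace a, ℝ)) :
    fibre (tensorInd W g) y = g := by
  ext x
  rw [fibre_apply, tensorInd_apply, indicator_of_mem (s := (W : Set L)) hy, one_mul]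

end Boxes

/-- Restriction to the fibre over `y`, as a bounded operator. -/
noncomputable def fibreCLM {A L : Type*} [TopologicalSpace A] [TopologicalSpace L] (y : L) :
    C₀(A × L, ℝ) →L[ℝ] C₀(A, ℝ) :=
  LinearMap.mkContinuous
    { toFun := fun f => fibre f y
      map_add' := fun _ _ => rfl
      map_smul' := fun _ _ => rfl } 1 fun f => by
    rw [one_mul]
    exact norm_fibre_le f y

/-! ### Decomposition of operators -/

section Operators

variable {a b : Ordinal.{0}} {L : Type*} [LinearOrder L] [TopologicalSpace L] [ClubSpace L]

theorem ClubSpace.bddAbove_of_countable {s : Set L} (hs : s.Countable) : ∃ g : L, s ⊆ Iic g := by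
  by_contra! h
  refine ClubSpace.uncountable (X := L) ((hs.biUnion fun x _ => countable_Iic x).mono fun a _ => ?_)
  obtain ⟨x, hx, hax⟩ := not_subset.1 (h a)
  exact mem_biUnion hx (not_le.1 hax).le

theorem countable_support_snd {B : Type*} [TopologicalSpace B] (f : C₀(B × L, ℝ)) :
    {y | ∃ x, f (x, y) ≠ 0}.Countable := by
  have h : ∀ n : ℕ, {y | ∃ x, 1 / ((n : ℝ) + 1) ≤ |f (x, y)|}.Countable := by
    intro n
    obtain ⟨K, hK, hf⟩ := C0_exists_compact f (e := 1 / ((n : ℝ) + 1)) (by positivity)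
    refine (ClubSpace.countable_of_isCompact (hK.image continuous_snd)).mono ?_
    rintro y ⟨x, hx⟩
    refine ⟨(x, y), ?_, rfl⟩
    by_contra hn
    exact (hf _ hn).not_ge hx
  refine (countable_iUnion h).mono ?_
  rintro y ⟨x, hx⟩
  obtain ⟨n, hn⟩ := exists_nat_one_div_lt (abs_pos.2 hx)
  exact mem_iUnion.2 ⟨n, x, hn.le⟩

/-- A separable set of functions lives on countably many fibres. -/
theorem exists_countable_of_isSeparable {B : Type*} [TopologicalSpace B] {s : Set C₀(B × L, ℝ)}
    (hs : TopologicalSpace.IsSeparable s) :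
    ∃ N : Set L, N.Countable ∧ ∀ f ∈ s, ∀ x, ∀ y ∉ N, f (x, y) = 0 := by
  obtain ⟨c, hc, hsc⟩ := hs
  refine ⟨⋃ f ∈ c, {y | ∃ x, f (x, y) ≠ 0}, hc.biUnion fun f _ => countable_support_snd f,
    fun f hf x y hy => ?_⟩
  have hcl : IsClosed {f : C₀(B × L, ℝ) | f (x, y) = 0} :=
    isClosed_eq (C0_continuous_eval _) continuous_const
  refine closure_minimal (fun g hg => ?_) hcl (hsc hf)
  by_contra hne
  exact hy (mem_biUnion hg ⟨x, hne⟩)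

/-- The functions that live on countably many given fibres form a separable set. -/
theorem isSeparable_of_countable (hb : b < Ordinal.omega 1) {N : Set L} (hN : N.Countable) :
    TopologicalSpace.IsSeparable {f : C₀(OrdinalSpace b × L, ℝ) | ∀ x, ∀ y ∉ N, f (x, y) = 0} := by
  obtain ⟨g, hg⟩ := ClubSpace.bddAbove_of_countable hN
  have : Countable (OrdinalSpace b) := (countable_Iio_of_lt_omega_one hb).to_subtype
  have hF : {f | ∃ (v : OrdinalSpace b) (W : CompactOpens L), (W : Set L) ⊆ Iic g ∧
      boxInd v W = f}.Countable := by
    refine ((countable_iUnion fun v : OrdinalSpace b =>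
      (ClubSpace.countable_compactOpens g).image (boxInd v))).mono ?_
    rintro f ⟨v, W, hW, rfl⟩
    exact mem_iUnion.2 ⟨v, W, hW, rfl⟩
  refine (hF.isSeparable.span (R := ℝ)).closure.mono fun f hf => ?_
  refine mem_closure_span_boxInd ClubSpace.exists_compactOpens (ClubSpace.isClopen_Iic g).isOpen f
    fun x y hne => ?_
  by_contra hy
  exact hne (hf x y fun hyN => hy (hg hyN))

/-- The fibrewise part of an operator is determined by its action on any fibre outside the countably
many ones that matter for the separable parts. -/
theorem fibrewise_add_unique {R R' : C₀(OrdinalSpace a, ℝ) →L[ℝ] C₀(OrdinalSpace b, ℝ)}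
    {S S' : C₀(OrdinalSpace a × L, ℝ) →L[ℝ] C₀(OrdinalSpace b × L, ℝ)}
    (hS : TopologicalSpace.IsSeparable (range S)) (hS' : TopologicalSpace.IsSeparable (range S'))
    (h : fibrewise L R + S = fibrewise L R' + S') : R = R' ∧ S = S' := by
  obtain ⟨N, hN, hSN⟩ := exists_countable_of_isSeparable hS
  obtain ⟨N', hN', hSN'⟩ := exists_countable_of_isSeparable hS'
  obtain ⟨y, hy⟩ : ∃ y, y ∉ N ∪ N' := by
    by_contra! hall
    exact ClubSpace.uncountable (X := L) ((hN.union hN').mono fun y _ => hall y)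
  rw [mem_union, not_or] at hy
  obtain ⟨W, hyW, -⟩ := ClubSpace.exists_compactOpens y univ isOpen_univ (mem_univ y)
  have hR : R = R' := by
    ext g x
    have hg := DFunLike.congr_fun (DFunLike.congr_fun h (tensorInd W g)) (x, y)
    simp only [add_apply, ZeroAtInftyContinuousMap.add_apply,
      fibrewise_apply, fibre_tensorInd hyW] at hg
    rwa [hSN _ (mem_range_self _) x y hy.1, hSN' _ (mem_range_self _) x y hy.2, add_zero,
      add_zero] at hg
  subst hR
  refine ⟨rfl, ?_⟩
  ext f p
  have hf := DFunLike.congr_fun (DFunLike.congr_fun h f) p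
  simpa using hf

variable [WellFoundedLT L]

/-- Up to countably many fibres, every bounded operator is a fibrewise operator `R_L`. -/
theorem exists_fibrewise (ha : a < Ordinal.omega 1) (hb : b < Ordinal.omega 1)
    (T : C₀(OrdinalSpace a × L, ℝ) →L[ℝ] C₀(OrdinalSpace b × L, ℝ)) :
    ∃ (R : C₀(OrdinalSpace a, ℝ) →L[ℝ] C₀(OrdinalSpace b, ℝ)) (N : Set L), N.Countable ∧
      ∀ f x, ∀ y ∉ N, T f (x, y) = fibrewise L R f (x, y) := by
  have : Countable (OrdinalSpace a) := (countable_Iio_of_lt_omega_one ha).to_subtype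
  have : Countable (OrdinalSpace b) := (countable_Iio_of_lt_omega_one hb).to_subtype
  have hscalar : ∀ (v : OrdinalSpace a) (x : OrdinalSpace b), ∃ (c : ℝ) (N : Set L),
      N.Countable ∧ ∀ y ∉ N, ∀ W : CompactOpens L,
        T (boxInd v W) (x, y) = (W : Set L).indicator (fun _ => c) y := by
    intro v x
    refine ClubSpace.exists_const (τ := fun W y => T (boxInd v W) (x, y)) ?_
      (fun W => (T (boxInd v W)).continuous.comp (by fun_prop))
      fun W => ?_
    swap
    · refine (countable_support_snd (T (boxInd v W))).mono fun y hy => ?_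
      exact ⟨x, hy⟩
    refine fun y => ⟨?_, ?_⟩
    · intro V W h
      rw [boxInd_sup_of_disjoint v h, map_add, ZeroAtInftyContinuousMap.add_apply]
    · refine ⟨‖T‖, fun V => (C0_norm_coe_le _ _).trans ((T.le_opNorm _).trans ?_)⟩
      exact mul_le_of_le_one_right (norm_nonneg _) (norm_C0Ind_le _)
  choose c N hN hc using hscalar
  have hNc : (⋃ v, ⋃ x, N v x).Countable :=
    countable_iUnion fun v => countable_iUnion fun x => hN v x
  have hmem : ∀ {y}, y ∉ (⋃ v, ⋃ x, N v x) → ∀ v x, y ∉ N v x := fun hy v x hm =>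
    hy (mem_iUnion.2 ⟨v, mem_iUnion.2 ⟨x, hm⟩⟩)
  obtain ⟨y₀, hy₀⟩ : ∃ y₀, y₀ ∉ ⋃ v, ⋃ x, N v x := by
    by_contra! h
    exact ClubSpace.uncountable (X := L) (hNc.mono fun y _ => h y)
  obtain ⟨W₀, hyW₀, -⟩ := ClubSpace.exists_compactOpens y₀ univ isOpen_univ (mem_univ y₀)
  let R : C₀(OrdinalSpace a, ℝ) →L[ℝ] C₀(OrdinalSpace b, ℝ) :=
    (fibreCLM y₀).comp (T.comp (tensorInd W₀))
  have hR : ∀ v x, R (C0Ind (ordinalIic v)) x = c v x := fun v x => by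
    change T (tensorInd W₀ (C0Ind (ordinalIic v))) (x, y₀) = c v x
    rw [tensorInd_C0Ind, hc v x y₀ (hmem hy₀ v x), indicator_of_mem (s := (W₀ : Set L)) hyW₀]
  refine ⟨R, _, hNc, fun f x y hy => ?_⟩
  have hdense : Dense (Submodule.span ℝ {g | ∃ (v : OrdinalSpace a) (W : CompactOpens L),
      (W : Set L) ⊆ univ ∧ boxInd v W = g} : Set C₀(OrdinalSpace a × L, ℝ)) := fun f =>
    mem_closure_span_boxInd ClubSpace.exists_compactOpens isOpen_univ f fun _ _ _ => mem_univ _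
  have hext : (C0Eval (x, y)).comp T = (C0Eval (x, y)).comp (fibrewise L R) := by
    refine ContinuousLinearMap.ext_on hdense ?_
    rintro _ ⟨v, W, -, rfl⟩
    change T (boxInd v W) (x, y) = fibrewise L R (boxInd v W) (x, y)
    rw [fibrewise_apply, hc v x y (hmem hy v x)]
    by_cases hyW : y ∈ W
    · rw [← tensorInd_C0Ind, fibre_tensorInd hyW, hR, indicator_of_mem (s := (W : Set L)) hyW]
    · have h0 : fibre (boxInd v W) y = 0 := by
        ext z
        exact C0Ind_of_notMem fun h => hyW h.2
      rw [h0, map_zero, indicator_of_notMem (s := (W : Set L)) hyW]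
      rfl
  exact DFunLike.congr_fun hext f

end Operators

theorem theorem2p4 (club : OstaszewskiClub) :
    ∃ (L : Type) (_ : TopologicalSpace L),
      LocallyCompactSpace L ∧ T2Space L ∧ IsScatteredSpace L ∧
      ¬ TopologicalSpace.MetrizableSpace L ∧
      ∀ a b : Ordinal.{0}, a < Ordinal.omega 1 → b < Ordinal.omega 1 →
        ∀ T : C₀(OrdinalSpace a × L, ℝ) →L[ℝ] C₀(OrdinalSpace b × L, ℝ),
          ∃! p : (C₀(OrdinalSpace a, ℝ) →L[ℝ] C₀(OrdinalSpace b, ℝ)) ×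
              (C₀(OrdinalSpace a × L, ℝ) →L[ℝ] C₀(OrdinalSpace b × L, ℝ)),
            TopologicalSpace.IsSeparable (Set.range p.2) ∧ T = fibrewise L p.1 + p.2 := by
  obtain ⟨L, _, _, _, _⟩ := club.exists_clubSpace
  refine ⟨L, inferInstance, inferInstance, inferInstance, ClubSpace.isScatteredSpace,
    ClubSpace.not_metrizableSpace, fun a b ha hb T => ?_⟩
  obtain ⟨R, N, hN, hR⟩ := exists_fibrewise ha hb T
  have hS : TopologicalSpace.IsSeparable (Set.range (T - fibrewise L R)) := by
    refine (isSeparable_of_countable hb hN).mono ?_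
    rintro _ ⟨f, rfl⟩ x y hy
    exact sub_eq_zero.2 (hR f x y hy)
  have hT : T = fibrewise L R + (T - fibrewise L R) := (add_sub_cancel (fibrewise L R) T).symm
  refine ⟨(R, T - fibrewise L R), ⟨hS, hT⟩, ?_⟩
  rintro ⟨R', S'⟩ ⟨hS', hT'⟩
  obtain ⟨h1, h2⟩ := fibrewise_add_unique hS' hS (hT'.symm.trans hT)
  exact Prod.ext h1 h2
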